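/- Let $k\ge 1$ be an integer, $\alpha>0$, let $\mathcal X,\mathcal Y$ be finite sets ($\mathcal X\neq\emptyset$), and let $Q(\cdot\mid\cdot)$ be a kernel: for each $u\in\mathcal X^k$, $Q(\cdot\mid u)$ is a probability distribution on $\mathcal Y$. **Hypothesis H.** For every $l\ge 1$, the function $$\Gamma_l(\nu)=\frac1{|\mathcal Y|}\sum_{u^{(1)},\dots,u^{(l)}\in\mathcal X^k}\Big[\sum_{z\in\mathcal Y}\prod_{r=1}^l\big(1-Q(z\mid u^{(r)})\big)\Big]\prod_{i=1}^k\nu\big(u^{(1)}_i,\dots,u^{(l)}_i\big)$$ is convex on the set of probability measures $\nu$ on $\mathcal X^l$. **Model.** For $n\ge k$, let $G_n$ be a random multi-hypergraph on $[n]$ with law $\mathcal P_k(\alpha,n)$: each $k$-subset $I$ of $[n]$ carries $m_I$ parallel hyperedges, where the $m_I$ are independent Poisson variables of parameter $\alpha n/\binom nk$. Each hyperedge is listed in some order $(i_1,\dots,i_k)$ of its vertices, and for $x\in\mathcal X^n$ one writes $x[e]=(x_{i_1},\dots,x_{i_k})$ for the hyperedge $e$ so listed. Concerning the listing, assume one of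 the following: 1. the order is immaterial for $Q$, that is, for every permutation $\pi$ of $\{1,\dots,k\}$ there is a permutation $\tau$ of $\mathcal Y$ with $Q(\tau(z)\mid u_{\pi(1)},\dots,u_{\pi(k)})=Q(z\mid u)$ for all $u,z$ (and the listing is then arbitrary); or 2. given the $m_I$, the orders of the individual hyperedges are independent and uniformly random. For a fixed multi-hypergraph $g$ on $[n]$, with hyperedge set $E(g)$ (counted with multiplicity), let $P_g(y\mid x)=\prod_{e\in E(g)}Q(y_e\mid x[e])$ for $x\in\mathcal X^n$, $y\in\mathcal Y^{E(g)}$. Let $S_g(y)=\sum_{x}|\mathcal X|^{-n}P_g(y\mid x)$ and $R_g(x\mid y)=|\mathcal X|^{-n}P_g(y\mid x)/S_g(y)$, and let $$H^{(n)}_g(X\mid Y)=-|\mathcal X|^{-n}\sum_{x\in\mathcal X^n}\sum_{y\in\mathcal Y^{E(g)}}P_g(y\mid x)\log_2R_g(x\mid y)$$ be the conditional entropy of the uniform vector $X$ on $\mathcal X^n$ given the output $Y$ of the channel $P_g$ (with $0\log_2 0=0$). Let $H^{(n)}(X\mid Y)=\mathbb E\,H^{(n)}_{G_n}(X\mid Y)$,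 an expectation that exists. **Theorem.** If $Q$ satisfies Hypothesis H, there is a constant $C_k(\alpha,Q)$, depending only on $k$, $\alpha$ and $Q$, such that $\frac1nH^{(n)}(X\mid Y)\to C_k(\alpha,Q)$ as $n\to\infty$ and, for any random hypergraphs $(G_n)_n$ as above defined on a common probability space (with any dependence between different $n$), almost surely $$\lim_{n\to\infty}\frac1n H^{(n)}_{G_n}(X\mid Y)=C_k(\alpha,Q).$$ -/

import Mathlib

open MeasureTheory ProbabilityTheory Filter Topology

noncomputable section

namespace GraphicalChannel

/-- A finite multi-hypergraph of order `k` on the vertex set `[n]`. A hyperedge is recorded together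
with the order `(e 0, …, e (k-1))` in which its `k` distinct vertices are fed to the kernel;
`g e` is the number of parallel hyperedges that are listed as `e`. -/
abbrev MultiHypergraph (k n : ℕ) : Type := (Fin k ↪ Fin n) → ℕ

/-- The set `E_k([n])` of all `n.choose k` (unordered) hyperedges of order `k`. -/
abbrev Edge (k n : ℕ) : Type := {I : Finset (Fin n) // I.card = k}

/-- `m_I`: the number of parallel hyperedges with underlying vertex set `I`, in whatever order
they are listed. -/
def multiplicity {k n : ℕ} (g : MultiHypergraph k n) (I : Edge k n) : ℕ :=
  ∑ e : Fin k ↪ Fin n with Finset.univ.map e = I.1, g e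

/-- The edge-variables: one symbol of `𝒴` for each hyperedge of `g`, with multiplicity. -/
abbrev EdgeVars (𝒴 : Type*) {k n : ℕ} (g : MultiHypergraph k n) : Type _ :=
  (e : Fin k ↪ Fin n) → Fin (g e) → 𝒴

section Channel

variable {𝒳 𝒴 : Type*} {k n : ℕ}

/-- `Q(· | u)` is a probability distribution on `𝒴` for every `u ∈ 𝒳^k`. -/
def IsKernel [Fintype 𝒴] (Q : (Fin k → 𝒳) → 𝒴 → ℝ) : Prop :=
  ∀ u, Q u ∈ stdSimplex ℝ 𝒴

/-- `P_g(y | x)`, the graphical channel with graph `g` and kernel `Q`. -/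
def channelProb (Q : (Fin k → 𝒳) → 𝒴 → ℝ) (g : MultiHypergraph k n)
    (x : Fin n → 𝒳) (y : EdgeVars 𝒴 g) : ℝ :=
  ∏ e : Fin k ↪ Fin n, ∏ i : Fin (g e), Q (fun j => x (e j)) (y e i)

variable (𝒳 n) in
/-- The probability of each point of `𝒳^n` under the uniform distribution. -/
def prior [Fintype 𝒳] : ℝ := ((Fintype.card 𝒳 : ℝ) ^ n)⁻¹

/-- `S_g(y)`, the output marginal distribution. -/
def outputProb [Fintype 𝒳] (Q : (Fin k → 𝒳) → 𝒴 → ℝ) (g : MultiHypergraph k n) (y : EdgeVars 𝒴 g) : ℝ :=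
  ∑ x : Fin n → 𝒳, channelProb Q g x y * prior 𝒳 n

/-- `R_g(x | y)`, the a posteriori distribution (reverse channel). -/
def reverseProb [Fintype 𝒳] (Q : (Fin k → 𝒳) → 𝒴 → ℝ) (g : MultiHypergraph k n)
    (x : Fin n → 𝒳) (y : EdgeVars 𝒴 g) : ℝ :=
  1 / outputProb Q g y * channelProb Q g x y * prior 𝒳 n

/-- `H_g^{(n)}(X | Y)`, the conditional entropy (in bits) of the node-variables given the
edge-variables, for a fixed hypergraph `g`. -/
def condEntropy [Fintype 𝒳] [Fintype 𝒴] (Q : (Fin k → 𝒳) → 𝒴 → ℝ) (g : MultiHypergraph k n) : ℝ :=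
  -(prior 𝒳 n * ∑ x : Fin n → 𝒳, ∑ y : EdgeVars 𝒴 g,
    channelProb Q g x y * Real.logb 2 (reverseProb Q g x y))

/-- The functional `Γ_l`, evaluated at a weight function `ν` on `𝒳^l`. Here `u r` is the
word `u^{(r)} ∈ 𝒳^k`. -/
def Gam [Fintype 𝒳] [Fintype 𝒴] (Q : (Fin k → 𝒳) → 𝒴 → ℝ) (l : ℕ) (ν : (Fin l → 𝒳) → ℝ) : ℝ :=
  1 / (Fintype.card 𝒴 : ℝ) * ∑ u : Fin l → Fin k → 𝒳,
    (∑ z : 𝒴, ∏ r : Fin l, (1 - Q (u r) z)) * ∏ i : Fin k, ν (fun r => u r i)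

/-- Hypothesis H: `Γ_l` is convex on the set of probability measures on `𝒳^l`, for all `l ≥ 1`. -/
def HypothesisH [Fintype 𝒳] [Fintype 𝒴] (Q : (Fin k → 𝒳) → 𝒴 → ℝ) : Prop :=
  ∀ l : ℕ, 1 ≤ l → ConvexOn ℝ (stdSimplex ℝ (Fin l → 𝒳)) (Gam Q l)

/-- The order in which the vertices of a hyperedge are fed to `Q` is immaterial: permuting the
inputs amounts to relabelling the output symbols. -/
def OrderInsensitive (Q : (Fin k → 𝒳) → 𝒴 → ℝ) : Prop :=
  ∀ π : Equiv.Perm (Fin k), ∃ τ : Equiv.Perm 𝒴, ∀ u z, Q (fun j => u (π j)) (τ z) = Q u z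

end Channel

section Random

variable {Ω : Type*} [MeasurableSpace Ω] {k n : ℕ}

/-- The random hypergraph `G` has the law `𝒫_k(α, n)`: the multiplicities `m_I`, `I ∈ E_k([n])`,
are independent Poisson variables of parameter `α n / (n choose k)`. Nothing is said about the
orders in which the hyperedges are listed. -/
def IsSparsePoisson (P : Measure Ω) (α : ℝ) (G : Ω → MultiHypergraph k n) : Prop :=
  P.map (fun ω => multiplicity (G ω)) =
    Measure.pi fun _ : Edge k n => poissonMeasure (α * n / (n.choose k : ℝ)).toNNReal

/-- `G` has the law `𝒫_k(α, n)` and, given the multiplicities, every single hyperedge is listed in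
one of the `k!` orders of its vertices, uniformly at random and independently of the others.
Equivalently (thinning of Poisson variables) the numbers of hyperedges with a given listing are
independent Poisson variables of parameter `(α n / (n choose k)) / k!`. -/
def IsUniformlyListedSparsePoisson (P : Measure Ω) (α : ℝ) (G : Ω → MultiHypergraph k n) : Prop :=
  P.map G = Measure.pi fun _ : Fin k ↪ Fin n =>
    poissonMeasure (α * n / (n.choose k : ℝ) / (k.factorial : ℝ)).toNNReal

end Random

end GraphicalChannel

end

/-!
The proof is an interpolation argument followed by a concentration bound.

Adding a hyperedge `e` to a hypergraph changes the conditional entropy by `H(Y_e | X) - H(Y_e | Y)`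
(`graphEntropy_add_single`). The first term is the same for all hyperedges with distinct vertices.
For the second, `-t log t = (1 - t) - ∑_{l ≥ 2} (1 - t)^l / (l (l - 1))` and the `l`-th power of a
posterior mean is a mean over `l` replicas; if the vertices of `e` are independent and uniform in a
set `W`, the average over `e` is a constant plus a combination, with negative coefficients, of the
`Γ_l` at the empirical law of the replicas over `W` (`hasSum_average_negMulLog`). The empirical law
over `[m + n]` is a mixture of those over the two parts `[m]` and `[n]`, so by Hypothesis H a random
global hyperedge lowers the entropy, up to `O(1/n)`, at least as much as a random hyperedge local to
one of the parts (`average_predictiveEntropy_superadditive`).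

To pass from one hyperedge to the whole Poisson hypergraph no derivative is needed. The mean of a
function under Poisson multiplicities is the exponential of a combination of commuting shift
operators (`hasSum_integral_poissonPi`), so hyperedges can be exchanged one at a time
(`integral_poissonPi_le`). When all hyperedges are local, the entropy is the sum of the entropies
of the two parts; hence the means are subadditive up to a constant (`mapMean_add_le`), and Fekete's
lemma applies. Allowing repeated vertices costs only `O(1)` (`abs_listingMean_sub_mapMean_le`).

Finally, the entropy is a Lipschitz function of independent Poisson variables of total rate `α n`,
so that its deviations of order `n` are exponentially unlikely (`poissonPi_real_abs_sub_ge_le`). The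
Borel–Cantelli lemma gives almost sure convergence, whatever the dependence between different `n`.
-/

noncomputable section

namespace GraphicalChannel

open scoped NNReal
open Real (negMulLog)

/-! ### Poisson means as exponentials of commuting shift operators -/

section PoissonCalculus

variable {E : Type*}

/-- The operator `(shift e F) g = F (g + δ_e)`: evaluate `F` after adding a copy of `e`. -/
def shift [DecidableEq E] (e : E) : Module.End ℝ ((E → ℕ) → ℝ) :=
  LinearMap.funLeft ℝ ℝ fun g => g + Pi.single e 1

/-- The operator `A_r = ∑ e, r e • shift e`. Up to normalisation it adds one random edge with law
proportional to `r`; the mean of `F` under independent Poisson multiplicities of rates `r` is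
`exp (-∑ r) • exp A_r`, applied to `F` and evaluated at the empty graph. -/
def generator [Fintype E] [DecidableEq E] (r : E → ℝ≥0) : Module.End ℝ ((E → ℕ) → ℝ) :=
  ∑ e, (r e : ℝ) • shift e

lemma shift_apply [DecidableEq E] (e : E) (F : (E → ℕ) → ℝ) (g : E → ℕ) :
    shift e F g = F (g + Pi.single e 1) := rfl

lemma generator_apply [Fintype E] [DecidableEq E] (r : E → ℝ≥0) (F : (E → ℕ) → ℝ) (g : E → ℕ) :
    generator r F g = ∑ e, (r e : ℝ) * F (g + Pi.single e 1) := by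
  simp [generator, shift_apply, Finset.sum_apply]

lemma commute_shift [DecidableEq E] (e e' : E) : Commute (shift e) (shift e') := by
  refine LinearMap.ext fun F => funext fun g => ?_
  simp [shift_apply, add_right_comm]

lemma commute_generator [Fintype E] [DecidableEq E] (r s : E → ℝ≥0) :
    Commute (generator r) (generator s) :=
  Commute.sum_left _ _ _ fun e _ => Commute.sum_right _ _ _ fun e' _ =>
    ((commute_shift e e').smul_left _).smul_right _

lemma smul_shift_pow_apply [DecidableEq E] (c : ℝ) (e : E) (j : ℕ) (F : (E → ℕ) → ℝ) (g : E → ℕ) :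
    ((c • shift e) ^ j) F g = c ^ j * F (g + Pi.single e j) := by
  induction j generalizing F g with
  | zero => simp
  | succ j ih =>
    rw [pow_succ, Module.End.mul_apply, ih]
    simp [shift_apply, pow_succ, mul_assoc, add_assoc, ← Pi.single_add]

lemma noncommProd_smul_shift_apply [DecidableEq E] (r : E → ℝ) (n : E → ℕ) (s : Finset E) (hc)
    (F : (E → ℕ) → ℝ) (g : E → ℕ) :
    s.noncommProd (fun e => (r e • shift e) ^ n e) hc F g =
      (∏ e ∈ s, r e ^ n e) * F (g + ∑ e ∈ s, Pi.single e (n e)) := by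
  induction s using Finset.cons_induction generalizing g with
  | empty => simp
  | cons a s ha ih =>
    rw [Finset.noncommProd_cons, Module.End.mul_apply, smul_shift_pow_apply, ih,
      Finset.prod_cons, Finset.sum_cons, mul_assoc, add_assoc]

/-- The multinomial theorem for the commuting operators `shift e`: the `m`-th power of the generator
evaluated at the empty graph sums over all graphs with `m` edges, with their Poisson weights. -/
lemma generator_pow_apply_zero [Fintype E] [DecidableEq E] (r : E → ℝ≥0) (m : ℕ)
    (F : (E → ℕ) → ℝ) :
    (generator r ^ m) F 0 = ∑ g ∈ Finset.piAntidiag Finset.univ m,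
      (m.factorial : ℝ) * ((∏ e, (r e : ℝ) ^ g e / (g e).factorial) * F g) := by
  have hc : ((Finset.univ : Finset E) : Set E).Pairwise
      (Function.onFun Commute fun e => (r e : ℝ) • shift e) := fun e _ e' _ _ =>
    ((commute_shift e e').smul_left _).smul_right _
  rw [generator, Finset.sum_pow_eq_sum_piAntidiag_of_commute _ _ hc, LinearMap.sum_apply,
    Finset.sum_apply]
  refine Finset.sum_congr rfl fun g hg => ?_
  have hm : ∑ e, g e = m := (Finset.mem_piAntidiag.1 hg).1
  have hmul := Nat.multinomial_spec Finset.univ g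
  rw [hm] at hmul
  have hmul' : (∏ e, ((g e).factorial : ℝ)) * Nat.multinomial Finset.univ g = m.factorial := by
    exact_mod_cast hmul
  rw [← nsmul_eq_mul, LinearMap.smul_apply, Pi.smul_apply, noncommProd_smul_shift_apply, zero_add,
    Finset.univ_sum_single, nsmul_eq_mul, ← hmul', Finset.prod_div_distrib]
  have : (∏ e, ((g e).factorial : ℝ)) ≠ 0 :=
    Finset.prod_ne_zero_iff.2 fun e _ => by positivity
  field_simp

variable [Fintype E]

/-- The law of a family of independent Poisson variables with rates `r`. -/
def poissonPi (r : E → ℝ≥0) : Measure (E → ℕ) := Measure.pi fun e => poissonMeasure (r e)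

instance (r : E → ℝ≥0) : IsProbabilityMeasure (poissonPi r) := by
  unfold poissonPi; infer_instance

lemma integrable_of_bounded {X : Type*} [MeasurableSpace X] [DiscreteMeasurableSpace X]
    (μ : Measure X) [IsFiniteMeasure μ] {F : X → ℝ} {M : ℝ}
    (hF : ∀ g, |F g| ≤ M) : Integrable F μ :=
  Integrable.of_bound (Measurable.of_discrete.aestronglyMeasurable) M (ae_of_all _ hF)

/-- Poisson means as an exponential series of the generator, obtained by conditioning on the total
number of edges. -/
lemma hasSum_integral_poissonPi [DecidableEq E] (r : E → ℝ≥0) {F : (E → ℕ) → ℝ} {M : ℝ}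
    (hF : ∀ g, |F g| ≤ M) :
    HasSum (fun m : ℕ => Real.exp (-∑ e, (r e : ℝ)) * ((generator r ^ m) F 0 / m.factorial))
      (∫ g, F g ∂poissonPi r) := by
  have hint : Integrable F (poissonPi r) := integrable_of_bounded _ hF
  have h1 : HasSum (fun g => (poissonPi r).real {g} * F g) (∫ g, F g ∂poissonPi r) := by
    rw [← Measure.sum_smul_dirac (poissonPi r)] at hint
    have h := hasSum_integral_measure hint
    rw [Measure.sum_smul_dirac] at h
    simpa [integral_smul_measure, measureReal_def] using h
  have h2 := h1.tsum_fiberwise fun g : E → ℕ => ∑ e, g e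
  convert! h2 using 1
  funext m
  symm
  have hset : (fun g : E → ℕ => ∑ e, g e) ⁻¹' {m} =
      ((Finset.piAntidiag Finset.univ m : Finset (E → ℕ)) : Set (E → ℕ)) := by
    ext g; simp
  rw [hset, Finset.tsum_subtype' _ fun g => (poissonPi r).real {g} * F g,
    generator_pow_apply_zero, ← Finset.mul_sum, mul_div_cancel_left₀ _ (by positivity),
    Finset.mul_sum]
  refine Finset.sum_congr rfl fun g _ => ?_
  have : (poissonPi r).real {g} =
      Real.exp (-∑ e, (r e : ℝ)) * ∏ e, (r e : ℝ) ^ g e / (g e).factorial := by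
    rw [measureReal_def, poissonPi, Measure.pi_singleton, ENNReal.toReal_prod,
      ← Finset.sum_neg_distrib, Real.exp_sum, ← Finset.prod_mul_distrib]
    refine Finset.prod_congr rfl fun e _ => ?_
    rw [← measureReal_def, poissonMeasure_real_singleton, mul_div_assoc]
  rw [this, mul_assoc]

/-! ### Comparison of two Poisson edge laws -/

lemma generator_mono [DecidableEq E] (r : E → ℝ≥0) {F F' : (E → ℕ) → ℝ} (h : ∀ g, F g ≤ F' g)
    (g : E → ℕ) : generator r F g ≤ generator r F' g := by
  simp only [generator_apply]
  exact Finset.sum_le_sum fun e _ => mul_le_mul_of_nonneg_left (h _) (r e).2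

lemma generator_pow_mono [DecidableEq E] (r : E → ℝ≥0) (m : ℕ) {F F' : (E → ℕ) → ℝ}
    (h : ∀ g, F g ≤ F' g) (g : E → ℕ) : (generator r ^ m) F g ≤ (generator r ^ m) F' g := by
  induction m generalizing F F' with
  | zero => exact h g
  | succ m ih =>
    rw [pow_succ, Module.End.mul_apply, Module.End.mul_apply]
    exact ih (generator_mono r h)

lemma generator_add_const [DecidableEq E] (r : E → ℝ≥0) (F : (E → ℕ) → ℝ) (c : ℝ) :
    generator r (fun g => F g + c) = fun g => generator r F g + (∑ e, (r e : ℝ)) * c := by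
  funext g
  simp [generator_apply, mul_add, Finset.sum_add_distrib, Finset.sum_mul]

lemma generator_pow_add_const [DecidableEq E] (r : E → ℝ≥0) (m : ℕ) (F : (E → ℕ) → ℝ) (c : ℝ) :
    (generator r ^ m) (fun g => F g + c) =
      fun g => (generator r ^ m) F g + (∑ e, (r e : ℝ)) ^ m * c := by
  induction m generalizing F c with
  | zero => simp
  | succ m ih =>
    rw [pow_succ, Module.End.mul_apply, Module.End.mul_apply, generator_add_const, ih]
    funext g
    ring

/-- Replacing the edges one by one: each replacement costs `c`, and as the generators commute the
other edges do not interfere. -/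
lemma generator_pow_le [DecidableEq E] {r s : E → ℝ≥0} (hrs : ∑ e, (r e : ℝ) = ∑ e, (s e : ℝ))
    {F : (E → ℕ) → ℝ} {c : ℝ} (h : ∀ g, generator r F g ≤ generator s F g + c) (m : ℕ)
    (g : E → ℕ) :
    (generator r ^ m) F g ≤
      (generator s ^ m) F g + m * (∑ e, (s e : ℝ)) ^ (m - 1) * c := by
  induction m generalizing g with
  | zero => simp
  | succ m ih =>
    have h1 : (generator r ^ (m + 1)) F g ≤
        (generator r ^ m) (generator s F) g + (∑ e, (s e : ℝ)) ^ m * c := by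
      rw [pow_succ, Module.End.mul_apply]
      refine (generator_pow_mono r m h g).trans_eq ?_
      rw [generator_pow_add_const, hrs]
    have h2 : (generator r ^ m) (generator s F) g = generator s ((generator r ^ m) F) g := by
      rw [← Module.End.mul_apply, ← Module.End.mul_apply,
        ((commute_generator r s).pow_left m).eq]
    have h3 := generator_mono s ih g
    simp only [generator_add_const] at h3
    rw [← Module.End.mul_apply (generator s) (generator s ^ m), ← pow_succ'] at h3
    rw [h2] at h1
    refine h1.trans ((add_le_add_left h3 _).trans_eq ?_)
    rcases m with _ | m
    · simp
    · simp only [Nat.add_sub_cancel, Nat.cast_add, Nat.cast_one]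
      ring

/-- A comparison of the generators of two Poisson edge laws of equal total rate, on every graph and
up to an error `c`, passes to the Poisson means with the same error: exchanging one edge costs `c`
over the total rate, and the total rate is the mean number of edges. -/
lemma integral_poissonPi_le [DecidableEq E] {r s : E → ℝ≥0}
    (hrs : ∑ e, (r e : ℝ) = ∑ e, (s e : ℝ)) {F : (E → ℕ) → ℝ} {c M : ℝ}
    (hF : ∀ g, |F g| ≤ M) (h : ∀ g, generator r F g ≤ generator s F g + c) :
    ∫ g, F g ∂poissonPi r ≤ ∫ g, F g ∂poissonPi s + c := by
  set L := ∑ e, (s e : ℝ)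
  have hexp : HasSum (fun m : ℕ => Real.exp (-L) *
      ((m : ℝ) * L ^ (m - 1) * c / m.factorial)) c := by
    rw [← hasSum_nat_add_iff' 1]
    have h1 := ((NormedSpace.expSeries_div_hasSum_exp L).mul_left (Real.exp (-L))).mul_right c
    rw [← Real.exp_eq_exp_ℝ, ← Real.exp_add] at h1
    simp only [neg_add_cancel, Real.exp_zero, one_mul] at h1
    convert! h1 using 1
    · funext m
      rw [Nat.factorial_succ]
      push_cast
      have : ((m : ℝ) + 1) ≠ 0 := by positivity
      field_simp
    · simp
  refine hasSum_le (fun m => ?_) (hasSum_integral_poissonPi r hF)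
    ((hasSum_integral_poissonPi s hF).add hexp)
  rw [hrs, ← mul_add, ← add_div]
  gcongr
  exact generator_pow_le hrs h m 0

/-! ### Merging edges -/

/-- The edge multiplicities obtained from `g` by identifying edges along `f : E → E'`. -/
def merge {E' : Type*} [DecidableEq E'] (f : E → E') (g : E → ℕ) (e' : E') : ℕ :=
  ∑ e with f e = e', g e

lemma merge_add_single {E' : Type*} [DecidableEq E] [DecidableEq E'] (f : E → E') (g : E → ℕ)
    (e : E) : merge f (g + Pi.single e 1) = merge f g + Pi.single (f e) 1 := by
  funext e'
  simp [merge, Finset.sum_add_distrib, Pi.single_apply, eq_comm (a := e')]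

lemma generator_comp_merge {E' : Type*} [Fintype E'] [DecidableEq E] [DecidableEq E'] (f : E → E')
    {r : E → ℝ≥0} {r' : E' → ℝ≥0} (hr : ∀ e', r' e' = ∑ e with f e = e', r e)
    (F : (E' → ℕ) → ℝ) :
    generator r (F ∘ merge f) = generator r' F ∘ merge f := by
  funext g
  simp only [generator_apply, Function.comp_apply, merge_add_single, hr, NNReal.coe_sum,
    Finset.sum_mul]
  rw [← Finset.sum_fiberwise Finset.univ f]
  refine Finset.sum_congr rfl fun e' _ => Finset.sum_congr rfl fun e he => ?_
  rw [(Finset.mem_filter.1 he).2]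

lemma generator_pow_comp_merge {E' : Type*} [Fintype E'] [DecidableEq E] [DecidableEq E']
    (f : E → E') {r : E → ℝ≥0} {r' : E' → ℝ≥0} (hr : ∀ e', r' e' = ∑ e with f e = e', r e) (m : ℕ)
    (F : (E' → ℕ) → ℝ) :
    (generator r ^ m) (F ∘ merge f) = (generator r' ^ m) F ∘ merge f := by
  induction m generalizing F with
  | zero => rfl
  | succ m ih =>
    rw [pow_succ, pow_succ, Module.End.mul_apply, Module.End.mul_apply, generator_comp_merge f hr,
      ih]

/-- Sums of independent Poisson variables over the fibres of `f` are independent Poisson variables,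
in the form of an identity of means. -/
lemma integral_comp_merge {E' : Type*} [Fintype E'] [DecidableEq E'] (f : E → E')
    {r : E → ℝ≥0} {r' : E' → ℝ≥0} (hr : ∀ e', r' e' = ∑ e with f e = e', r e)
    {F : (E' → ℕ) → ℝ} {M : ℝ} (hF : ∀ g, |F g| ≤ M) :
    ∫ g, F (merge f g) ∂poissonPi r = ∫ g, F g ∂poissonPi r' := by
  classical
  have h1 := hasSum_integral_poissonPi r (F := F ∘ merge f) fun g => hF _
  refine h1.unique ?_
  convert! hasSum_integral_poissonPi r' hF using 1
  have h0 : merge f (0 : E → ℕ) = 0 := by funext e'; simp [merge]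
  have hsum : ∑ e, (r e : ℝ) = ∑ e', (r' e' : ℝ) := by
    rw [← Finset.sum_fiberwise Finset.univ f]
    simp [hr]
  funext m
  rw [generator_pow_comp_merge f hr, hsum, Function.comp_apply, h0]

lemma map_merge_poissonPi {E' : Type*} [Fintype E'] [DecidableEq E'] (f : E → E')
    {r : E → ℝ≥0} {r' : E' → ℝ≥0} (hr : ∀ e', r' e' = ∑ e with f e = e', r e) :
    (poissonPi r).map (merge f) = poissonPi r' := by
  ext s hs
  have h := integral_comp_merge f hr (F := s.indicator 1) (M := 1) fun g => by
    by_cases hg : g ∈ s <;> simp [hg]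
  have h' : (fun g => s.indicator (1 : (E' → ℕ) → ℝ) (merge f g)) =
      (merge f ⁻¹' s).indicator 1 := by
    funext g; rfl
  rw [h', integral_indicator_one (.of_discrete), integral_indicator_one hs,
    measureReal_def, measureReal_def, ENNReal.toReal_eq_toReal_iff' (by simp) (by simp)] at h
  rw [Measure.map_apply .of_discrete hs, h]

end PoissonCalculus

/-! ### Exponential concentration for independent Poisson variables -/

section Concentration

lemma hasSum_exp_mul_poisson (r : ℝ≥0) (t : ℝ) :
    HasSum (fun n : ℕ => Real.exp (-r) * (r : ℝ) ^ n / n.factorial * Real.exp (t * n))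
      (Real.exp (r * (Real.exp t - 1))) := by
  have h := (NormedSpace.expSeries_div_hasSum_exp ((r : ℝ) * Real.exp t)).mul_left (Real.exp (-r))
  rw [← Real.exp_eq_exp_ℝ, ← Real.exp_add] at h
  convert! h using 1
  · funext n
    rw [mul_pow, ← Real.exp_nat_mul, mul_comm (n : ℝ) t]
    ring
  · ring_nf

lemma integrable_exp_mul_poisson (r : ℝ≥0) (t : ℝ) :
    Integrable (fun n : ℕ => Real.exp (t * n)) (poissonMeasure r) := by
  rw [integrable_poissonMeasure_iff]
  simpa using (hasSum_exp_mul_poisson r t).summable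

lemma integral_exp_mul_poisson (r : ℝ≥0) (t : ℝ) :
    ∫ n : ℕ, Real.exp (t * n) ∂poissonMeasure r = Real.exp (r * (Real.exp t - 1)) := by
  rw [integral_poissonMeasure]
  exact (hasSum_exp_mul_poisson r t).tsum_eq

lemma abs_sub_le_of_lipschitz {f : ℕ → ℝ} {c : ℝ} (hf : ∀ n, |f (n + 1) - f n| ≤ c) (a b : ℕ) :
    |f a - f b| ≤ |c * ((a : ℝ) - b)| := by
  have key : ∀ a j : ℕ, |f (a + j) - f a| ≤ c * j := fun a j => by
    induction j with
    | zero => simp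
    | succ j ih =>
      have := abs_sub_le (f (a + (j + 1))) (f (a + j)) (f a)
      have h2 := hf (a + j)
      rw [← add_assoc] at this ⊢
      push_cast
      linarith
  rcases le_total b a with h | h
  · obtain ⟨j, rfl⟩ := Nat.exists_eq_add_of_le h
    refine (key b j).trans ((le_abs_self _).trans_eq ?_)
    push_cast; ring_nf
  · obtain ⟨j, rfl⟩ := Nat.exists_eq_add_of_le h
    rw [abs_sub_comm]
    refine (key a j).trans ((neg_le_abs _).trans_eq' ?_)
    push_cast; ring_nf

/-- Exponential moment of a Lipschitz function of one Poisson variable `N`. By Jensen it is at most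
`𝔼 exp (f N - f N')` with `N'` an independent copy, which by symmetry is `𝔼 cosh (f N - f N')`, and
the Lipschitz bound reduces this to `𝔼 cosh (c (N - N'))`. -/
lemma integral_exp_sub_poisson_le (r : ℝ≥0) {f : ℕ → ℝ} {M c : ℝ} (hM : ∀ n, |f n| ≤ M)
    (hf : ∀ n, |f (n + 1) - f n| ≤ c) :
    ∫ n, Real.exp (f n - ∫ m, f m ∂poissonMeasure r) ∂poissonMeasure r ≤
      Real.exp (r * (2 * Real.cosh c - 2)) := by
  set μ := poissonMeasure r
  have hbd : ∀ t : ℝ, ∀ n, |Real.exp (t * f n)| ≤ Real.exp (|t| * M) := fun t n => by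
    rw [abs_of_pos (Real.exp_pos _), Real.exp_le_exp]
    refine (le_abs_self _).trans ?_
    rw [abs_mul]
    exact mul_le_mul_of_nonneg_left (hM n) (abs_nonneg t)
  have hi : ∀ t : ℝ, Integrable (fun n => Real.exp (t * f n)) μ := fun t =>
    integrable_of_bounded μ (hbd t)
  have hi1 : Integrable (fun n => Real.exp (f n)) μ := by simpa using hi 1
  have hi2 : Integrable (fun n => Real.exp (-f n)) μ := by simpa using hi (-1)
  have hJ : Real.exp (-∫ m, f m ∂μ) ≤ ∫ m, Real.exp (-f m) ∂μ := by
    rw [← integral_neg]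
    exact convexOn_exp.map_integral_le Real.continuous_exp.continuousOn isClosed_univ
      (by simp) (integrable_of_bounded μ hM).neg hi2
  -- Symmetrisation over two independent copies.
  have hsym : ∀ u v : ℕ → ℝ, Integrable u μ → Integrable v μ →
      Integrable (fun z : ℕ × ℕ => (u z.1 * v z.2 + v z.1 * u z.2) / 2) (μ.prod μ) ∧
      ∫ z, (u z.1 * v z.2 + v z.1 * u z.2) / 2 ∂μ.prod μ = (∫ n, u n ∂μ) * ∫ n, v n ∂μ := by
    intro u v hu hv
    have h1 : Integrable (fun z : ℕ × ℕ => u z.1 * v z.2) (μ.prod μ) := hu.mul_prod hv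
    have h2 : Integrable (fun z : ℕ × ℕ => v z.1 * u z.2) (μ.prod μ) := hv.mul_prod hu
    refine ⟨(h1.add h2).div_const 2, ?_⟩
    rw [integral_div, integral_add h1 h2, integral_prod_mul, integral_prod_mul]
    ring
  obtain ⟨i1, e1⟩ := hsym _ _ hi1 hi2
  obtain ⟨i2, e2⟩ := hsym _ _ (integrable_exp_mul_poisson r c) (integrable_exp_mul_poisson r (-c))
  have hcosh : ∀ a b : ℝ, (Real.exp a * Real.exp (-b) + Real.exp (-a) * Real.exp b) / 2 =
      Real.cosh (a - b) := fun a b => by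
    rw [Real.cosh_eq, ← Real.exp_add, ← Real.exp_add]
    ring_nf
  calc ∫ n, Real.exp (f n - ∫ m, f m ∂μ) ∂μ
      = (∫ n, Real.exp (f n) ∂μ) * Real.exp (-∫ m, f m ∂μ) := by
        simp_rw [sub_eq_add_neg, Real.exp_add, integral_mul_const]
    _ ≤ (∫ n, Real.exp (f n) ∂μ) * ∫ m, Real.exp (-f m) ∂μ :=
        mul_le_mul_of_nonneg_left hJ (integral_nonneg fun _ => (Real.exp_pos _).le)
    _ ≤ (∫ n : ℕ, Real.exp (c * n) ∂μ) * ∫ n : ℕ, Real.exp (-c * n) ∂μ := by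
        rw [← e1, ← e2]
        refine integral_mono i1 i2 fun z => ?_
        simp only [neg_mul, hcosh, ← mul_sub]
        exact Real.cosh_le_cosh.2 (abs_sub_le_of_lipschitz hf _ _)
    _ = Real.exp (r * (2 * Real.cosh c - 2)) := by
        rw [integral_exp_mul_poisson, integral_exp_mul_poisson, ← Real.exp_add, Real.cosh_eq]
        ring_nf

/-- Tensorisation of `integral_exp_sub_poisson_le`: integrating out one coordinate preserves the
Lipschitz bound in the others. -/
lemma integral_exp_sub_poissonPi_fin_le {N : ℕ} (r : Fin N → ℝ≥0) {F : (Fin N → ℕ) → ℝ} {M c : ℝ}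
    (hM : ∀ g, |F g| ≤ M) (hF : ∀ g e, |F (g + Pi.single e 1) - F g| ≤ c) :
    ∫ g, Real.exp (F g - ∫ g', F g' ∂poissonPi r) ∂poissonPi r ≤
      Real.exp ((∑ e, (r e : ℝ)) * (2 * Real.cosh c - 2)) := by
  induction N with
  | zero =>
    have : ∀ g, F g = F 0 := fun g => by rw [Subsingleton.elim g 0]
    simp [this]
  | succ N ih =>
    set μ := poissonMeasure (r 0)
    set ν := poissonPi fun e : Fin N => r e.succ
    have hmp : MeasurePreserving (MeasurableEquiv.piFinSuccAbove (fun _ => ℕ) 0) (poissonPi r)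
        (μ.prod ν) := measurePreserving_piFinSuccAbove (fun e => poissonMeasure (r e)) 0
    have hint : ∀ H : (Fin (N + 1) → ℕ) → ℝ, (∃ B, ∀ g, |H g| ≤ B) →
        ∫ g, H g ∂poissonPi r = ∫ g', ∫ a, H (Fin.cons a g') ∂μ ∂ν := fun H ⟨B, hB⟩ => by
      have h1 := (hmp.symm).integral_comp' H
      rw [← h1, integral_prod_symm _ (integrable_of_bounded _ fun _ => hB _)]
      simp [MeasurableEquiv.piFinSuccAbove, Fin.insertNthEquiv, Fin.insertNth_zero']
    set G : (Fin N → ℕ) → ℝ := fun g' => ∫ a, F (Fin.cons a g') ∂μ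
    have hG : ∀ g', |G g'| ≤ M := fun g' => by
      refine (abs_integral_le_integral_abs).trans ?_
      refine (integral_mono (integrable_of_bounded μ (M := M) fun a => ?_)
        (integrable_const M) fun a => hM _).trans_eq (by simp)
      rw [abs_abs]; exact hM _
    have hGl : ∀ g' e, |G (g' + Pi.single e 1) - G g'| ≤ c := fun g' e => by
      rw [← integral_sub (integrable_of_bounded μ fun a => hM _)
        (integrable_of_bounded μ fun a => hM _)]
      refine (abs_integral_le_integral_abs).trans ?_
      have hc : ∀ a, |F (Fin.cons a (g' + Pi.single e 1)) - F (Fin.cons a g')| ≤ c := fun a => by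
        have := hF (Fin.cons a g') e.succ
        have e1 : (Fin.cons a g' : Fin (N + 1) → ℕ) + Pi.single e.succ 1 =
            Fin.cons a (g' + Pi.single e 1) := by
          funext i
          refine Fin.cases ?_ (fun i => ?_) i
          · simp
          · simp [Pi.single_apply]
        rwa [e1] at this
      refine (integral_mono (integrable_of_bounded μ (M := c) fun a => ?_)
        (integrable_const c) hc).trans_eq (by simp)
      rw [abs_abs]; exact hc a
    have hmean : ∫ g, F g ∂poissonPi r = ∫ g', G g' ∂ν := hint F ⟨M, hM⟩
    have hM0 : 0 ≤ M := (abs_nonneg _).trans (hM 0)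
    have hE : ∀ x y : ℝ, |x| ≤ M → |y| ≤ M → |Real.exp (x - y)| ≤ Real.exp (2 * M) := by
      intro x y hx hy
      rw [abs_of_pos (Real.exp_pos _), Real.exp_le_exp]
      linarith [(abs_le.1 hx).2, (abs_le.1 hy).1]
    have hGm : |∫ g', G g' ∂ν| ≤ M := by
      refine (abs_integral_le_integral_abs).trans ?_
      refine (integral_mono (integrable_of_bounded ν (M := M) fun a => ?_)
        (integrable_const M) fun a => hG _).trans_eq (by simp)
      rw [abs_abs]; exact hG _
    rw [hint _ ⟨Real.exp (2 * M), fun g => hE _ _ (hM _) (by rw [hmean]; exact hGm)⟩, hmean]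
    have hstep : ∀ g', ∫ a, Real.exp (F (Fin.cons a g') - ∫ g', G g' ∂ν) ∂μ ≤
        Real.exp (r 0 * (2 * Real.cosh c - 2)) * Real.exp (G g' - ∫ g', G g' ∂ν) := by
      intro g'
      have h1 := integral_exp_sub_poisson_le (r 0) (f := fun a => F (Fin.cons a g'))
        (M := M) (c := c) (fun a => hM _) fun a => by
          have := hF (Fin.cons a g') 0
          have e1 : (Fin.cons a g' : Fin (N + 1) → ℕ) + Pi.single 0 1 = Fin.cons (a + 1) g' := by
            funext i
            refine Fin.cases ?_ (fun i => ?_) i <;> simp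
          rwa [e1] at this
      have h2 : ∀ a, Real.exp (F (Fin.cons a g') - ∫ g', G g' ∂ν) =
          Real.exp (F (Fin.cons a g') - G g') * Real.exp (G g' - ∫ g', G g' ∂ν) := fun a => by
        rw [← Real.exp_add]; ring_nf
      simp_rw [h2, integral_mul_const]
      exact mul_le_mul_of_nonneg_right h1 (Real.exp_pos _).le
    refine (integral_mono_of_nonneg (ae_of_all _ fun g' => integral_nonneg fun a =>
      (Real.exp_pos _).le) ?_ (ae_of_all _ hstep)).trans ?_
    · exact (integrable_of_bounded ν fun g' => hE _ _ (hG g') hGm).const_mul _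
    · rw [integral_const_mul, Fin.sum_univ_succ, add_mul, Real.exp_add]
      exact mul_le_mul_of_nonneg_left (ih _ hG hGl) (Real.exp_pos _).le

lemma integral_exp_sub_poissonPi_le {E : Type*} [Fintype E] [DecidableEq E] (r : E → ℝ≥0)
    {F : (E → ℕ) → ℝ} {M c : ℝ} (hM : ∀ g, |F g| ≤ M)
    (hF : ∀ g e, |F (g + Pi.single e 1) - F g| ≤ c) :
    ∫ g, Real.exp (F g - ∫ g', F g' ∂poissonPi r) ∂poissonPi r ≤
      Real.exp ((∑ e, (r e : ℝ)) * (2 * Real.cosh c - 2)) := by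
  let f := (Fintype.equivFin E).symm
  have hr : ∀ e, r e = ∑ i with f i = e, r (f i) := fun e => by
    rw [Finset.sum_filter, Finset.sum_eq_single (f.symm e)] <;> simp
    rintro i hi rfl
    simp at hi
  have h1 := integral_exp_sub_poissonPi_fin_le (fun i => r (f i)) (F := F ∘ merge f)
    (fun g => hM _) fun g i => by
      simp only [Function.comp_apply, merge_add_single]
      exact hF _ _
  have h2 := integral_comp_merge f hr hM
  have h3 := integral_comp_merge f hr (F := fun g => Real.exp (F g - ∫ g', F g' ∂poissonPi r))
    (M := Real.exp (M - ∫ g', F g' ∂poissonPi r)) fun g => by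
      rw [abs_of_pos (Real.exp_pos _), Real.exp_le_exp]
      exact sub_le_sub_right ((le_abs_self _).trans (hM g)) _
  simp only [Function.comp_apply, h2, h3] at h1
  rwa [Equiv.sum_comp f fun e => (r e : ℝ)] at h1

/-- Two-sided Chernoff bound for Lipschitz functions of independent Poisson variables. It depends on
the rates only through their sum. -/
lemma poissonPi_real_abs_sub_ge_le {E : Type*} [Fintype E] [DecidableEq E] (r : E → ℝ≥0)
    {F : (E → ℕ) → ℝ} {M c : ℝ} (hM : ∀ g, |F g| ≤ M)
    (hF : ∀ g e, |F (g + Pi.single e 1) - F g| ≤ c) {θ : ℝ} (hθ : 0 ≤ θ) (t : ℝ) :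
    (poissonPi r).real {g | t ≤ |F g - ∫ g', F g' ∂poissonPi r|} ≤
      2 * Real.exp (-θ * t + (∑ e, (r e : ℝ)) * (2 * Real.cosh (θ * c) - 2)) := by
  have key : ∀ H : (E → ℕ) → ℝ, (∀ g, |H g| ≤ M) → (∀ g e, |H (g + Pi.single e 1) - H g| ≤ c) →
      (poissonPi r).real {g | t ≤ H g - ∫ g', H g' ∂poissonPi r} ≤
        Real.exp (-θ * t + (∑ e, (r e : ℝ)) * (2 * Real.cosh (θ * c) - 2)) := by
    intro H hHM hH
    have hθM : ∀ g, |θ * H g| ≤ θ * M := fun g => by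
      rw [abs_mul, abs_of_nonneg hθ]
      exact mul_le_mul_of_nonneg_left (hHM g) hθ
    have h1 := integral_exp_sub_poissonPi_le r (F := fun g => θ * H g) (M := θ * M) (c := θ * c)
      hθM fun g e => by
        rw [← mul_sub, abs_mul, abs_of_nonneg hθ]
        exact mul_le_mul_of_nonneg_left (hH g e) hθ
    rw [integral_const_mul] at h1
    have h2 := measure_ge_le_exp_mul_mgf (μ := poissonPi r)
      (X := fun g => H g - ∫ g', H g' ∂poissonPi r) t hθ
      (integrable_of_bounded _ (M := Real.exp (θ * M - θ * ∫ g', H g' ∂poissonPi r)) fun g => by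
        rw [abs_of_pos (Real.exp_pos _), Real.exp_le_exp, mul_sub]
        exact sub_le_sub_right ((le_abs_self _).trans (hθM g)) _)
    rw [Real.exp_add]
    refine h2.trans (mul_le_mul_of_nonneg_left ?_ (Real.exp_pos _).le)
    simp only [mgf, mul_sub]
    simpa only [mul_sub] using h1
  have k1 := key F hM hF
  have k2 := key (fun g => -F g) (fun g => by rw [abs_neg]; exact hM g) fun g e => by
    rw [neg_sub_neg, abs_sub_comm]; exact hF g e
  rw [integral_neg] at k2
  have hsub : {g | t ≤ |F g - ∫ g', F g' ∂poissonPi r|} ⊆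
      {g | t ≤ F g - ∫ g', F g' ∂poissonPi r} ∪
        {g | t ≤ -F g - -∫ g', F g' ∂poissonPi r} := fun g hg => by
    rcases le_abs.1 (show t ≤ |_| from hg) with h | h
    · exact Or.inl h
    · exact Or.inr (by rw [Set.mem_ofPred_eq]; linarith)
  refine (measureReal_mono hsub).trans ((measureReal_union_le _ _).trans ?_)
  linarith

end Concentration

/-! ### The equivocation functional -/

section Equivocation

variable {A B : Type*} [Fintype A] [Fintype B]

/-- `∑ η (v a) - η (∑ v a)` with `η t = -t log t`. For `v a = ℙ(X = a, Y = y)` with `y` fixed this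
is `ℙ(Y = y)` times the entropy (in nats) of `X` given `Y = y`; for a probability vector `v` it is
the entropy of `v`. -/
def equivocation (v : A → ℝ) : ℝ := ∑ a, negMulLog (v a) - negMulLog (∑ a, v a)

lemma equivocation_smul (c : ℝ) (v : A → ℝ) :
    equivocation (fun a => c * v a) = c * equivocation v := by
  simp only [equivocation, Real.negMulLog_mul, Finset.sum_add_distrib, ← Finset.sum_mul,
    ← Finset.mul_sum]
  ring

lemma equivocation_comp_equiv (σ : A ≃ B) (v : B → ℝ) :
    equivocation (fun a => v (σ a)) = equivocation v := by
  simp only [equivocation]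
  rw [σ.sum_comp v, σ.sum_comp fun b => negMulLog (v b)]

lemma equivocation_eq_sum_mul_log {v : A → ℝ} (hv : ∀ a, 0 ≤ v a) :
    equivocation v = -∑ a, v a * Real.log (v a / ∑ b, v b) := by
  have h : negMulLog (∑ a, v a) = -∑ a, v a * Real.log (∑ b, v b) := by
    rw [Real.negMulLog, neg_mul, Finset.sum_mul]
  rw [equivocation, h, ← Finset.sum_neg_distrib, ← Finset.sum_neg_distrib,
    ← Finset.sum_sub_distrib]
  refine Finset.sum_congr rfl fun a _ => ?_
  rcases (hv a).eq_or_lt with h | h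
  · simp [← h]
  · have hS : 0 < ∑ b, v b :=
      h.trans_le (Finset.single_le_sum (fun b _ => hv b) (Finset.mem_univ a))
    rw [Real.log_div h.ne' hS.ne', Real.negMulLog]
    ring

lemma equivocation_nonneg {v : A → ℝ} (hv : ∀ a, 0 ≤ v a) : 0 ≤ equivocation v := by
  rw [equivocation_eq_sum_mul_log hv, Left.nonneg_neg_iff]
  refine Finset.sum_nonpos fun a _ => mul_nonpos_of_nonneg_of_nonpos (hv a) (Real.log_nonpos ?_ ?_)
  · exact div_nonneg (hv a) (Finset.sum_nonneg fun b _ => hv b)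
  · exact div_le_one_of_le₀ (Finset.single_le_sum (fun b _ => hv b) (Finset.mem_univ a))
      (Finset.sum_nonneg fun b _ => hv b)

lemma equivocation_le {v : A → ℝ} (hv : ∀ a, 0 ≤ v a) :
    equivocation v ≤ (∑ a, v a) * Real.log (Fintype.card A) := by
  rw [equivocation_eq_sum_mul_log hv, ← Finset.sum_neg_distrib, Finset.sum_mul, ← sub_nonneg,
    ← Finset.sum_sub_distrib]
  set S := ∑ b, v b
  have key : ∀ a, v a - S / Fintype.card A ≤
      v a * Real.log (Fintype.card A) - -(v a * Real.log (v a / S)) := fun a => by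
    have hS0 : 0 ≤ S := Finset.sum_nonneg fun b _ => hv b
    rcases (hv a).eq_or_lt with h | h
    · simp only [← h, zero_mul, zero_sub, neg_zero, sub_zero, neg_nonpos]
      positivity
    · have hS : 0 < S := h.trans_le (Finset.single_le_sum (fun b _ => hv b) (Finset.mem_univ a))
      have : Nonempty A := ⟨a⟩
      have hN : (0 : ℝ) < Fintype.card A := by exact_mod_cast Fintype.card_pos
      have h1 := Real.one_sub_inv_le_log_of_pos (x := Fintype.card A * (v a / S)) (by positivity)
      rw [Real.log_mul hN.ne' (by positivity)] at h1
      have h2 := mul_le_mul_of_nonneg_left h1 h.le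
      refine le_trans (le_of_eq ?_) (h2.trans_eq (by ring))
      field_simp
  refine le_trans ?_ (Finset.sum_le_sum fun a _ => key a)
  rw [Finset.sum_sub_distrib, Finset.sum_const, nsmul_eq_mul, Finset.card_univ]
  rcases isEmpty_or_nonempty A with hA | hA
  · simp [S]
  · have hN : (Fintype.card A : ℝ) ≠ 0 := by exact_mod_cast Fintype.card_ne_zero
    rw [mul_div_cancel₀ _ hN, sub_self]

lemma equivocation_mul (v : A → ℝ) (w : B → ℝ) :
    equivocation (fun p : A × B => v p.1 * w p.2) =
      equivocation v * ∑ b, w b + (∑ a, v a) * equivocation w := by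
  simp only [equivocation, Fintype.sum_prod_type, ← Finset.mul_sum, ← Finset.sum_mul,
    Real.negMulLog_mul, Finset.sum_add_distrib]
  ring

/-- Chain rule: the effect of observing a further symbol `b`, produced from `a` by the kernel `q`.
The last term is the entropy of the new symbol, the one before it the entropy of its noise. -/
lemma sum_equivocation_mul (v : A → ℝ) {q : A → B → ℝ} (hq : ∀ a, ∑ b, q a b = 1) :
    ∑ b, equivocation (fun a => v a * q a b) =
      equivocation v + ∑ a, v a * equivocation (q a) - equivocation fun b => ∑ a, v a * q a b := by
  have h1 : ∑ b, ∑ a, v a * q a b = ∑ a, v a := by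
    rw [Finset.sum_comm]; simp [← Finset.mul_sum, hq]
  have h2 : ∑ b, ∑ a, negMulLog (v a * q a b) =
      ∑ a, negMulLog (v a) + ∑ a, v a * ∑ b, negMulLog (q a b) := by
    rw [Finset.sum_comm, ← Finset.sum_add_distrib]
    refine Finset.sum_congr rfl fun a _ => ?_
    simp only [Real.negMulLog_mul, Finset.sum_add_distrib, ← Finset.sum_mul, ← Finset.mul_sum, hq,
      one_mul]
  simp only [equivocation, Finset.sum_sub_distrib, h1, h2, hq, Real.negMulLog_one, sub_zero]
  ring

end Equivocation

/-! ### Entropy of a family of hyperedges -/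

section Family

variable {𝒳 𝒴 V ι : Type*} {k : ℕ}

/-- The probability of the symbols `y` given the vertex labels `x`, for the family `s` of
hyperedges. Here a hyperedge is any map `Fin k → V`; repeated vertices are allowed. -/
def likelihood [Fintype ι] (Q : (Fin k → 𝒳) → 𝒴 → ℝ) (s : ι → Fin k → V) (y : ι → 𝒴)
    (x : V → 𝒳) : ℝ :=
  ∏ i, Q (fun j => x (s i j)) (y i)

variable {Q : (Fin k → 𝒳) → 𝒴 → ℝ}

lemma equivocation_kernel_le [Fintype 𝒴] (hQ : IsKernel Q) (u : Fin k → 𝒳) :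
    equivocation (Q u) ≤ Real.log (Fintype.card 𝒴) := by
  simpa [(hQ u).2] using equivocation_le (hQ u).1

lemma likelihood_nonneg [Fintype 𝒴] [Fintype ι] (hQ : IsKernel Q) (s : ι → Fin k → V)
    (y : ι → 𝒴) (x : V → 𝒳) : 0 ≤ likelihood Q s y x :=
  Finset.prod_nonneg fun _ _ => (hQ _).1 _

lemma sum_likelihood [Fintype 𝒴] [Fintype ι] [DecidableEq ι] (hQ : IsKernel Q)
    (s : ι → Fin k → V) (x : V → 𝒳) :
    ∑ y, likelihood Q s y x = 1 := by
  simp only [likelihood]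
  rw [← Fintype.piFinset_univ, ← Finset.prod_univ_sum]
  exact Finset.prod_eq_one fun i _ => (hQ _).2

variable [Fintype 𝒳] [Fintype 𝒴] [Fintype V] [Fintype ι] [DecidableEq V] [DecidableEq ι]

/-- The conditional entropy, in nats, of uniform vertex labels given the edge symbols, for a finite
indexed family `s` of hyperedges on `V`. -/
def familyEntropy (Q : (Fin k → 𝒳) → 𝒴 → ℝ) (s : ι → Fin k → V) : ℝ :=
  ((Fintype.card 𝒳 : ℝ) ^ Fintype.card V)⁻¹ * ∑ y : ι → 𝒴, equivocation (likelihood Q s y)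

/-- `H(Y_e | X)`: the entropy of the symbol of a hyperedge `e` given the vertex labels. -/
def noiseEntropy (Q : (Fin k → 𝒳) → 𝒴 → ℝ) (e : Fin k → V) : ℝ :=
  ((Fintype.card 𝒳 : ℝ) ^ Fintype.card V)⁻¹ * ∑ x : V → 𝒳, equivocation (Q fun j => x (e j))

/-- `H(Y_e | Y)`: the entropy of the symbol of a new hyperedge `e` given the symbols `Y` of the
family `s`. -/
def predictiveEntropy (Q : (Fin k → 𝒳) → 𝒴 → ℝ) (s : ι → Fin k → V) (e : Fin k → V) : ℝ :=
  ((Fintype.card 𝒳 : ℝ) ^ Fintype.card V)⁻¹ * ∑ y : ι → 𝒴,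
    equivocation fun z => ∑ x, likelihood Q s y x * Q (fun j => x (e j)) z

lemma sum_sum_likelihood (hQ : IsKernel Q) (s : ι → Fin k → V) :
    ∑ y, ∑ x, likelihood Q s y x = (Fintype.card 𝒳 : ℝ) ^ Fintype.card V := by
  rw [Finset.sum_comm]
  simp [sum_likelihood hQ]

lemma familyEntropy_comp_equiv {ι' : Type*} [Fintype ι'] [DecidableEq ι'] (σ : ι ≃ ι')
    (s : ι' → Fin k → V) : familyEntropy Q (fun i => s (σ i)) = familyEntropy Q s := by
  rw [familyEntropy, familyEntropy]
  congr 1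
  rw [← (σ.arrowCongr (Equiv.refl 𝒴)).sum_comp]
  refine Finset.sum_congr rfl fun y _ => ?_
  congr 1
  funext x
  simp only [likelihood]
  rw [← σ.prod_comp]
  simp

/-- The entropy depends only on how often each hyperedge occurs in the family. -/
lemma familyEntropy_congr {ι' : Type*} [Fintype ι'] [DecidableEq ι'] {s : ι → Fin k → V}
    {s' : ι' → Fin k → V}
    (h : ∀ e, Fintype.card {i // s i = e} = Fintype.card {i // s' i = e}) :
    familyEntropy Q s = familyEntropy Q s' := by
  rw [← familyEntropy_comp_equiv (Equiv.ofFiberEquiv fun e => Fintype.equivOfCardEq (h e)) s']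
  congr 1
  funext i
  exact (Equiv.ofFiberEquiv_map _ i).symm

/-- `H(X | Y, Y_e) = H(X | Y) + H(Y_e | X) - H(Y_e | Y)`. -/
lemma familyEntropy_option (hQ : IsKernel Q) (s : ι → Fin k → V) (e : Fin k → V) :
    familyEntropy Q (fun i : Option ι => i.elim e s) =
      familyEntropy Q s + noiseEntropy Q e - predictiveEntropy Q s e := by
  rw [familyEntropy, familyEntropy, noiseEntropy, predictiveEntropy, ← mul_add, ← mul_sub]
  congr 1
  have h1 : ∑ x : V → 𝒳, equivocation (Q fun j => x (e j)) =
      ∑ y : ι → 𝒴, ∑ x, likelihood Q s y x * equivocation (Q fun j => x (e j)) := by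
    rw [Finset.sum_comm]
    simp [← Finset.sum_mul, sum_likelihood hQ]
  rw [h1, ← Finset.sum_add_distrib, ← Finset.sum_sub_distrib,
    ← (Equiv.piOptionEquivProd (β := fun _ : Option ι => 𝒴)).symm.sum_comp,
    Fintype.sum_prod_type, Finset.sum_comm]
  refine Finset.sum_congr rfl fun y _ => ?_
  rw [← sum_equivocation_mul _ fun x => (hQ _).2]
  refine Finset.sum_congr rfl fun z _ => ?_
  congr 1
  funext x
  simp [likelihood, Fintype.prod_option, mul_comm, Equiv.piOptionEquivProd]

variable [Nonempty 𝒳]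

lemma prior_pos (V : Type*) [Fintype V] : 0 < ((Fintype.card 𝒳 : ℝ) ^ Fintype.card V)⁻¹ := by
  have : (0 : ℝ) < Fintype.card 𝒳 := by exact_mod_cast Fintype.card_pos
  positivity

lemma familyEntropy_nonneg (hQ : IsKernel Q) (s : ι → Fin k → V) : 0 ≤ familyEntropy Q s :=
  mul_nonneg (prior_pos V).le (Finset.sum_nonneg fun y _ =>
    equivocation_nonneg (likelihood_nonneg hQ s y))

lemma familyEntropy_le (hQ : IsKernel Q) (s : ι → Fin k → V) :
    familyEntropy Q s ≤ Fintype.card V * Real.log (Fintype.card 𝒳) := by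
  have h := Finset.sum_le_sum fun (y : ι → 𝒴) (_ : y ∈ Finset.univ) =>
    equivocation_le (likelihood_nonneg hQ s y)
  rw [← Finset.sum_mul, sum_sum_likelihood hQ] at h
  refine (mul_le_mul_of_nonneg_left h (prior_pos V).le).trans_eq ?_
  rw [← mul_assoc, inv_mul_cancel₀ (inv_pos.1 (prior_pos V)).ne', one_mul, Fintype.card_fun,
    Nat.cast_pow, Real.log_pow]

lemma noiseEntropy_nonneg (hQ : IsKernel Q) (e : Fin k → V) : 0 ≤ noiseEntropy Q e :=
  mul_nonneg (prior_pos V).le (Finset.sum_nonneg fun _ _ => equivocation_nonneg (hQ _).1)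

lemma noiseEntropy_le (hQ : IsKernel Q) (e : Fin k → V) :
    noiseEntropy Q e ≤ Real.log (Fintype.card 𝒴) := by
  have h := Finset.sum_le_sum fun (x : V → 𝒳) (_ : x ∈ Finset.univ) =>
    equivocation_kernel_le hQ fun j => x (e j)
  refine (mul_le_mul_of_nonneg_left h (prior_pos V).le).trans_eq ?_
  rw [Finset.sum_const, nsmul_eq_mul, Finset.card_univ, Fintype.card_fun, Nat.cast_pow, ← mul_assoc,
    inv_mul_cancel₀ (inv_pos.1 (prior_pos V)).ne', one_mul]

lemma predictiveEntropy_nonneg (hQ : IsKernel Q) (s : ι → Fin k → V) (e : Fin k → V) :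
    0 ≤ predictiveEntropy Q s e :=
  mul_nonneg (prior_pos V).le (Finset.sum_nonneg fun _ _ => equivocation_nonneg fun _ =>
    Finset.sum_nonneg fun _ _ => mul_nonneg (likelihood_nonneg hQ _ _ _) ((hQ _).1 _))

lemma predictiveEntropy_le (hQ : IsKernel Q) (s : ι → Fin k → V) (e : Fin k → V) :
    predictiveEntropy Q s e ≤ Real.log (Fintype.card 𝒴) := by
  have h := Finset.sum_le_sum fun (y : ι → 𝒴) (_ : y ∈ Finset.univ) =>
    equivocation_le (v := fun z => ∑ x, likelihood Q s y x * Q (fun j => x (e j)) z) fun _ =>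
      Finset.sum_nonneg fun _ _ => mul_nonneg (likelihood_nonneg hQ _ _ _) ((hQ _).1 _)
  have h1 : ∀ y, ∑ z, ∑ x, likelihood Q s y x * Q (fun j => x (e j)) z =
      ∑ x, likelihood Q s y x := fun y => by
    rw [Finset.sum_comm]
    simp [← Finset.mul_sum, (hQ _).2]
  simp only [h1] at h
  rw [← Finset.sum_mul, sum_sum_likelihood hQ] at h
  refine (mul_le_mul_of_nonneg_left h (prior_pos V).le).trans_eq ?_
  rw [← mul_assoc, inv_mul_cancel₀ (inv_pos.1 (prior_pos V)).ne', one_mul]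

/-- Additivity over a splitting of the vertex set that no hyperedge crosses. -/
lemma familyEntropy_sum (hQ : IsKernel Q) {V₁ V₂ ι₁ ι₂ : Type*} [Fintype V₁] [Fintype V₂]
    [Fintype ι₁] [Fintype ι₂] [DecidableEq V₁] [DecidableEq V₂] [DecidableEq ι₁] [DecidableEq ι₂]
    (σ : V₁ ⊕ V₂ ≃ V) (s₁ : ι₁ → Fin k → V₁) (s₂ : ι₂ → Fin k → V₂) :
    familyEntropy Q (Sum.elim (fun i j => σ (.inl (s₁ i j))) fun i j => σ (.inr (s₂ i j))) =
      familyEntropy Q s₁ + familyEntropy Q s₂ := by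
  set s := Sum.elim (fun i j => σ (.inl (s₁ i j))) fun i j => σ (.inr (s₂ i j))
  have hy : ∀ (y₁ : ι₁ → 𝒴) (y₂ : ι₂ → 𝒴),
      equivocation (likelihood Q s (Sum.elim y₁ y₂)) =
        equivocation (likelihood Q s₁ y₁) * (∑ x, likelihood Q s₂ y₂ x) +
          (∑ x, likelihood Q s₁ y₁ x) * equivocation (likelihood Q s₂ y₂) := fun y₁ y₂ => by
    rw [← equivocation_mul, ← equivocation_comp_equiv
      ((σ.symm.arrowCongr (Equiv.refl 𝒳)).trans (Equiv.sumArrowEquivProdArrow V₁ V₂ 𝒳))]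
    congr 1
    funext x
    simp [likelihood, s, Fintype.prod_sum_type, Equiv.sumArrowEquivProdArrow]
  have hcard : Fintype.card V = Fintype.card V₁ + Fintype.card V₂ := by
    rw [← Fintype.card_congr σ, Fintype.card_sum]
  have h1 := inv_mul_cancel₀ (inv_pos.1 (prior_pos (𝒳 := 𝒳) V₁)).ne'
  have h2 := inv_mul_cancel₀ (inv_pos.1 (prior_pos (𝒳 := 𝒳) V₂)).ne'
  have hsum : ∑ y, equivocation (likelihood Q s y) =
      (∑ y, equivocation (likelihood Q s₁ y)) * (Fintype.card 𝒳 : ℝ) ^ Fintype.card V₂ +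
      (Fintype.card 𝒳 : ℝ) ^ Fintype.card V₁ * ∑ y, equivocation (likelihood Q s₂ y) := by
    rw [← (Equiv.sumArrowEquivProdArrow ι₁ ι₂ 𝒴).symm.sum_comp, Fintype.sum_prod_type,
      ← sum_sum_likelihood hQ s₁, ← sum_sum_likelihood hQ s₂, Finset.sum_mul_sum,
      Finset.sum_mul_sum, ← Finset.sum_add_distrib]
    refine Finset.sum_congr rfl fun y₁ _ => ?_
    rw [← Finset.sum_add_distrib]
    exact Finset.sum_congr rfl fun y₂ _ => hy y₁ y₂
  rw [familyEntropy, familyEntropy, familyEntropy, hsum, hcard, pow_add, mul_inv]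
  linear_combination (((Fintype.card 𝒳 : ℝ) ^ Fintype.card V₁)⁻¹ *
    ∑ y, equivocation (likelihood Q s₁ y)) * h2 + (((Fintype.card 𝒳 : ℝ) ^ Fintype.card V₂)⁻¹ *
    ∑ y, equivocation (likelihood Q s₂ y)) * h1

/-- Distinct vertices carry independent uniform labels, so the noise entropy of a hyperedge without
repeated vertices does not depend on the hyperedge or on the number of vertices. -/
lemma noiseEntropy_of_injective {e : Fin k → V} (he : Function.Injective e) :
    noiseEntropy Q e =
      ((Fintype.card 𝒳 : ℝ) ^ k)⁻¹ * ∑ u : Fin k → 𝒳, equivocation (Q u) := by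
  have hcard : Fintype.card V = k + Fintype.card {v // v ∉ Set.range e} := by
    have h1 := Fintype.card_congr (Equiv.sumCompl fun v => v ∈ Set.range e)
    have h2 : Fintype.card {v // v ∈ Set.range e} = k :=
      (Fintype.card_congr (Equiv.ofInjective e he)).symm.trans (Fintype.card_fin k)
    rw [Fintype.card_sum, h2] at h1
    exact h1.symm
  have hsum : ∑ x : V → 𝒳, equivocation (Q fun j => x (e j)) =
      (∑ u : Fin k → 𝒳, equivocation (Q u)) *
        (Fintype.card 𝒳 : ℝ) ^ Fintype.card {v // v ∉ Set.range e} := by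
    rw [← (Equiv.piEquivPiSubtypeProd (fun v => v ∈ Set.range e) fun _ => 𝒳).symm.sum_comp,
      Fintype.sum_prod_type,
      ← ((Equiv.ofInjective e he).arrowCongr (Equiv.refl 𝒳)).sum_comp, Finset.sum_mul]
    refine Finset.sum_congr rfl fun u _ => ?_
    simp [Equiv.piEquivPiSubtypeProd, mul_comm]
  rw [noiseEntropy, hsum, hcard, pow_add, mul_inv]
  have := inv_mul_cancel₀ (inv_pos.1 (prior_pos (𝒳 := 𝒳) {v // v ∉ Set.range e})).ne'
  linear_combination (((Fintype.card 𝒳 : ℝ) ^ k)⁻¹ * ∑ u, equivocation (Q u)) * this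

end Family

/-! ### Replica expansion and convexity -/

section Interpolation

/-- The expansion `-t log t = (1 - t) - ∑_{l ≥ 2} (1 - t)^l / (l (l - 1))` on `[0, 1]`, with
`l = m + 2`. -/
lemma hasSum_one_sub_pow_div {t : ℝ} (h0 : 0 ≤ t) (h1 : t ≤ 1) :
    HasSum (fun m : ℕ => (1 - t) ^ (m + 2) / (((m : ℝ) + 1) * (m + 2))) (1 - t - negMulLog t) := by
  have hsplit : ∀ m : ℕ, (1 - t) ^ (m + 2) / (((m : ℝ) + 1) * (m + 2)) =
      (1 - t) * ((1 - t) ^ (m + 1) / (m + 1)) - (1 - t) ^ (m + 2) / (m + 2) := fun m => by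
    field_simp
    ring
  rcases h0.eq_or_lt with rfl | h0
  · rw [Real.negMulLog_zero, hasSum_iff_tendsto_nat_of_nonneg fun m => by positivity]
    have : ∀ N : ℕ, ∑ m ∈ Finset.range N, (1 - (0 : ℝ)) ^ (m + 2) / (((m : ℝ) + 1) * (m + 2)) =
        1 - 0 - 1 / ((N : ℝ) + 1) - 0 := fun N => by
      induction N with
      | zero => simp
      | succ N ih =>
        rw [Finset.sum_range_succ, ih]
        push_cast
        field_simp
        ring
    simp_rw [this]
    simpa using (tendsto_one_div_add_atTop_nhds_zero_nat (𝕜 := ℝ)).const_sub 1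
  · have hx : |1 - t| < 1 := by rw [abs_lt]; constructor <;> linarith
    have hs := Real.hasSum_pow_div_log_of_abs_lt_one hx
    have hs' := (hasSum_nat_add_iff' 1).2 hs
    simp_rw [hsplit]
    convert! (hs.mul_left (1 - t)).sub hs' using 1
    · funext m
      push_cast
      ring_nf
    · simp [negMulLog]
      ring

variable {𝒳 𝒴 V W : Type*} {k l : ℕ}

/-- The empirical law on `𝒳^l` of the columns `(x⁽¹⁾_v, …, x⁽ˡ⁾_v)` of `l` labelings, where
`v = j w` and `w` is uniform in `W`. -/
def empiricalMeasure [Fintype W] [DecidableEq 𝒳] (j : W → V) (x : Fin l → V → 𝒳)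
    (a : Fin l → 𝒳) : ℝ :=
  (Fintype.card W : ℝ)⁻¹ * ∑ w, if (fun r => x r (j w)) = a then 1 else 0

lemma empiricalMeasure_mem_stdSimplex [Fintype W] [Nonempty W] [Fintype 𝒳] [DecidableEq 𝒳]
    (j : W → V) (x : Fin l → V → 𝒳) : empiricalMeasure j x ∈ stdSimplex ℝ (Fin l → 𝒳) := by
  refine ⟨fun a => by unfold empiricalMeasure; positivity, ?_⟩
  simp only [empiricalMeasure, ← Finset.mul_sum]
  rw [Finset.sum_comm]
  simp

lemma average_eq_sum_prod_empiricalMeasure [Fintype W] [DecidableEq W] [Fintype 𝒳] [DecidableEq 𝒳]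
    (j : W → V) (x : Fin l → V → 𝒳) (f : (Fin l → Fin k → 𝒳) → ℝ) :
    ((Fintype.card W : ℝ) ^ k)⁻¹ * ∑ e : Fin k → W, f (fun r i => x r (j (e i))) =
      ∑ u, f u * ∏ i, empiricalMeasure j x fun r => u r i := by
  have h : ∀ u : Fin l → Fin k → 𝒳, ∏ i, empiricalMeasure j x (fun r => u r i) =
      ((Fintype.card W : ℝ) ^ k)⁻¹ *
        ∑ e : Fin k → W, if (fun r i => x r (j (e i))) = u then 1 else 0 := fun u => by
    simp only [empiricalMeasure]
    rw [Finset.prod_mul_distrib, Finset.prod_const, Finset.card_univ, Fintype.card_fin, inv_pow,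
      Finset.prod_univ_sum, Fintype.piFinset_univ]
    congr 1
    refine Finset.sum_congr rfl fun e _ => ?_
    by_cases hu : (fun r i => x r (j (e i))) = u
    · subst hu
      simp
    · obtain ⟨r, hr⟩ := Function.ne_iff.1 hu
      obtain ⟨i, hi⟩ := Function.ne_iff.1 hr
      rw [if_neg hu]
      exact Finset.prod_eq_zero (Finset.mem_univ i) (if_neg fun h => hi (congrFun h r))
  simp_rw [h, mul_left_comm (f _), ← Finset.mul_sum]
  congr 1
  simp_rw [Finset.mul_sum]
  rw [Finset.sum_comm]
  simp

variable [Fintype 𝒳] [Fintype 𝒴] {Q : (Fin k → 𝒳) → 𝒴 → ℝ}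

/-- Expanding the `l`-th power of a posterior mean into `l` replicas turns the average over
hyperedges with independent uniform vertices into `Γ_l` of an empirical law. -/
lemma average_one_sub_pow_eq [Fintype V] [DecidableEq V] [Fintype W] [DecidableEq W]
    [DecidableEq 𝒳] (Q : (Fin k → 𝒳) → 𝒴 → ℝ) (j : W → V)
    {p : (V → 𝒳) → ℝ} (hp : ∑ x, p x = 1) (l : ℕ) :
    ((Fintype.card W : ℝ) ^ k)⁻¹ * ∑ e : Fin k → W, ∑ z,
        (1 - ∑ x, p x * Q (fun i => x (j (e i))) z) ^ l =
      ∑ x : Fin l → V → 𝒳, (∏ r, p (x r)) *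
        (Fintype.card 𝒴 * Gam Q l (empiricalMeasure j x)) := by
  have hG : ∀ x : Fin l → V → 𝒳, (Fintype.card 𝒴 : ℝ) * Gam Q l (empiricalMeasure j x) =
      ((Fintype.card W : ℝ) ^ k)⁻¹ * ∑ e : Fin k → W,
        ∑ z, ∏ r, (1 - Q (fun i => x r (j (e i))) z) := fun x => by
    rw [average_eq_sum_prod_empiricalMeasure j x fun u => ∑ z, ∏ r, (1 - Q (u r) z), Gam,
      ← mul_assoc]
    rcases isEmpty_or_nonempty 𝒴 with h | h
    · simp
    · rw [mul_one_div_cancel (by exact_mod_cast Fintype.card_ne_zero), one_mul]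
  simp_rw [hG, mul_left_comm _ ((Fintype.card W : ℝ) ^ k)⁻¹, ← Finset.mul_sum]
  congr 1
  simp_rw [Finset.mul_sum]
  conv_rhs => rw [Finset.sum_comm]
  refine Finset.sum_congr rfl fun e _ => ?_
  conv_rhs => rw [Finset.sum_comm]
  refine Finset.sum_congr rfl fun z _ => ?_
  have h1 : 1 - ∑ x, p x * Q (fun i => x (j (e i))) z =
      ∑ x, p x * (1 - Q (fun i => x (j (e i))) z) := by
    simp [mul_sub, hp]
  rw [h1, Finset.sum_pow', Fintype.piFinset_univ]
  simp [Finset.prod_mul_distrib]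

omit [Fintype 𝒳] in
lemma empiricalMeasure_sum {V₁ V₂ : Type*} [Fintype V] [Fintype V₁] [Fintype V₂] [Nonempty V₁]
    [Nonempty V₂] [DecidableEq 𝒳] (σ : V₁ ⊕ V₂ ≃ V) (x : Fin l → V → 𝒳) :
    empiricalMeasure id x =
      ((Fintype.card V₁ : ℝ) / Fintype.card V) • empiricalMeasure (fun v => σ (.inl v)) x +
      ((Fintype.card V₂ : ℝ) / Fintype.card V) • empiricalMeasure (fun v => σ (.inr v)) x := by
  funext a
  have h1 : (Fintype.card V₁ : ℝ) ≠ 0 := by exact_mod_cast Fintype.card_ne_zero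
  have h2 : (Fintype.card V₂ : ℝ) ≠ 0 := by exact_mod_cast Fintype.card_ne_zero
  simp only [empiricalMeasure, Pi.add_apply, Pi.smul_apply, smul_eq_mul, id]
  rw [← σ.sum_comp, Fintype.sum_sum_type]
  field_simp

/-- For hyperedges with independent uniform vertices in `W`, the deficit of the average predictive
entropy is a series in the functionals `Γ_l`, `l ≥ 2`, with positive coefficients. -/
lemma hasSum_average_negMulLog [Fintype V] [DecidableEq V] [Fintype W] [DecidableEq W] [Nonempty W]
    [DecidableEq 𝒳] (hQ : IsKernel Q) (j : W → V) {p : (V → 𝒳) → ℝ}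
    (hp : p ∈ stdSimplex ℝ (V → 𝒳)) :
    HasSum (fun m : ℕ => (((m : ℝ) + 1) * (m + 2))⁻¹ * (Fintype.card W *
      ∑ x : Fin (m + 2) → V → 𝒳, (∏ r, p (x r)) *
        (Fintype.card 𝒴 * Gam Q (m + 2) (empiricalMeasure j x))))
    (Fintype.card W * (Fintype.card 𝒴 - 1 - ((Fintype.card W : ℝ) ^ k)⁻¹ * ∑ e : Fin k → W, ∑ z,
      negMulLog (∑ x, p x * Q (fun i => x (j (e i))) z))) := by
  have hQ1 : ∀ u z, Q u z ≤ 1 := fun u z =>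
    (Finset.single_le_sum (fun z _ => (hQ u).1 z) (Finset.mem_univ z)).trans_eq (hQ u).2
  have h0 : ∀ (e : Fin k → W) z, 0 ≤ ∑ x, p x * Q (fun i => x (j (e i))) z := fun e z =>
    Finset.sum_nonneg fun x _ => mul_nonneg (hp.1 x) ((hQ _).1 z)
  have h1 : ∀ (e : Fin k → W) z, ∑ x, p x * Q (fun i => x (j (e i))) z ≤ 1 := fun e z => by
    rw [← hp.2]
    exact Finset.sum_le_sum fun x _ => mul_le_of_le_one_right (hp.1 x) (hQ1 _ _)
  have h2 : ∀ (e : Fin k → W), ∑ z, ∑ x, p x * Q (fun i => x (j (e i))) z = 1 := fun e => by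
    rw [Finset.sum_comm]
    simp [← Finset.mul_sum, (hQ _).2, hp.2]
  have hs := ((hasSum_sum (s := Finset.univ) fun (e : Fin k → W) _ =>
    hasSum_sum (s := Finset.univ) fun (z : 𝒴) _ =>
      hasSum_one_sub_pow_div (h0 e z) (h1 e z)).mul_left
        ((Fintype.card W : ℝ) ^ k)⁻¹).mul_left (Fintype.card W : ℝ)
  convert! hs using 1
  · funext m
    rw [← average_one_sub_pow_eq Q j hp.2]
    simp_rw [← Finset.sum_div]
    ring
  · congr 1
    have hW : (Fintype.card W : ℝ) ≠ 0 := by exact_mod_cast Fintype.card_ne_zero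
    simp only [Finset.sum_sub_distrib, h2, Finset.sum_const, Finset.card_univ, nsmul_eq_mul,
      Fintype.card_fun, Fintype.card_fin, mul_one, Nat.cast_pow]
    field_simp

/-- The empirical law of the whole vertex set is a mixture of those of its two parts, so convexity
of `Γ_l` makes the predictive entropy of a random global hyperedge at least that of a random local one. -/
lemma average_sum_negMulLog_superadditive {V₁ V₂ : Type*} [Fintype V] [Fintype V₁] [Fintype V₂]
    [Nonempty V₁] [Nonempty V₂] [DecidableEq V] [DecidableEq V₁] [DecidableEq V₂]
    (hQ : IsKernel Q) (hH : HypothesisH Q) (σ : V₁ ⊕ V₂ ≃ V)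
    {p : (V → 𝒳) → ℝ} (hp : p ∈ stdSimplex ℝ (V → 𝒳)) :
    Fintype.card V₁ * (((Fintype.card V₁ : ℝ) ^ k)⁻¹ * ∑ e : Fin k → V₁, ∑ z,
        negMulLog (∑ x, p x * Q (fun i => x (σ (.inl (e i)))) z)) +
      Fintype.card V₂ * (((Fintype.card V₂ : ℝ) ^ k)⁻¹ * ∑ e : Fin k → V₂, ∑ z,
        negMulLog (∑ x, p x * Q (fun i => x (σ (.inr (e i)))) z)) ≤
    Fintype.card V * (((Fintype.card V : ℝ) ^ k)⁻¹ * ∑ e : Fin k → V, ∑ z,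
        negMulLog (∑ x, p x * Q (fun i => x (e i)) z)) := by
  classical
  have : Nonempty V := ⟨σ (.inl (Classical.arbitrary V₁))⟩
  have hcard : (Fintype.card V : ℝ) = Fintype.card V₁ + Fintype.card V₂ := by
    rw [← Fintype.card_congr σ, Fintype.card_sum, Nat.cast_add]
  have hV : (0 : ℝ) < Fintype.card V := by exact_mod_cast Fintype.card_pos
  have key := hasSum_le (fun m => ?_) (hasSum_average_negMulLog hQ id hp)
    ((hasSum_average_negMulLog hQ (fun v => σ (.inl v)) hp).add
      (hasSum_average_negMulLog hQ (fun v => σ (.inr v)) hp))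
  · simp only [id] at key
    linear_combination key - ((Fintype.card 𝒴 : ℝ) - 1) * hcard
  · rw [← mul_add]
    refine mul_le_mul_of_nonneg_left ?_ (by positivity)
    simp_rw [Finset.mul_sum]
    rw [← Finset.sum_add_distrib]
    refine Finset.sum_le_sum fun x _ => ?_
    have hconv := (hH (m + 2) (by omega)).2
      (empiricalMeasure_mem_stdSimplex (fun v => σ (.inl v)) x)
      (empiricalMeasure_mem_stdSimplex (fun v => σ (.inr v)) x)
      (show 0 ≤ (Fintype.card V₁ : ℝ) / Fintype.card V by positivity)
      (show 0 ≤ (Fintype.card V₂ : ℝ) / Fintype.card V by positivity)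
      (by rw [← add_div, ← hcard, div_self hV.ne'])
    rw [← empiricalMeasure_sum, smul_eq_mul, smul_eq_mul] at hconv
    have h3 := mul_le_mul_of_nonneg_left hconv hV.le
    have h4 : (Fintype.card V : ℝ) * ((Fintype.card V₁ : ℝ) / Fintype.card V *
        Gam Q (m + 2) (empiricalMeasure (fun v => σ (.inl v)) x) +
        (Fintype.card V₂ : ℝ) / Fintype.card V *
        Gam Q (m + 2) (empiricalMeasure (fun v => σ (.inr v)) x)) =
        Fintype.card V₁ * Gam Q (m + 2) (empiricalMeasure (fun v => σ (.inl v)) x) +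
        Fintype.card V₂ * Gam Q (m + 2) (empiricalMeasure (fun v => σ (.inr v)) x) := by
      field_simp
    rw [h4] at h3
    have hw : 0 ≤ (∏ r, p (x r)) * (Fintype.card 𝒴 : ℝ) :=
      mul_nonneg (Finset.prod_nonneg fun r _ => hp.1 _) (Nat.cast_nonneg _)
    refine le_trans (le_of_eq ?_) ((mul_le_mul_of_nonneg_left h3 hw).trans_eq ?_) <;> ring

/-- Averaging `average_sum_negMulLog_superadditive` over the edge symbols already observed. -/
lemma average_predictiveEntropy_superadditive {V₁ V₂ ι : Type*} [Fintype V] [Fintype V₁]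
    [Fintype V₂] [Nonempty V₁] [Nonempty V₂] [DecidableEq V] [DecidableEq V₁] [DecidableEq V₂]
    [Fintype ι] [DecidableEq ι] [Nonempty 𝒳]
    (hQ : IsKernel Q) (hH : HypothesisH Q) (σ : V₁ ⊕ V₂ ≃ V) (s : ι → Fin k → V) :
    Fintype.card V₁ * (((Fintype.card V₁ : ℝ) ^ k)⁻¹ * ∑ e : Fin k → V₁,
        predictiveEntropy Q s fun i => σ (.inl (e i))) +
      Fintype.card V₂ * (((Fintype.card V₂ : ℝ) ^ k)⁻¹ * ∑ e : Fin k → V₂,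
        predictiveEntropy Q s fun i => σ (.inr (e i))) ≤
    Fintype.card V * (((Fintype.card V : ℝ) ^ k)⁻¹ * ∑ e : Fin k → V,
        predictiveEntropy Q s e) := by
  have key : ∀ y : ι → 𝒴,
      Fintype.card V₁ * (((Fintype.card V₁ : ℝ) ^ k)⁻¹ * ∑ e : Fin k → V₁,
        equivocation fun z => ∑ x, likelihood Q s y x * Q (fun i => x (σ (.inl (e i)))) z) +
      Fintype.card V₂ * (((Fintype.card V₂ : ℝ) ^ k)⁻¹ * ∑ e : Fin k → V₂,
        equivocation fun z => ∑ x, likelihood Q s y x * Q (fun i => x (σ (.inr (e i)))) z) ≤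
      Fintype.card V * (((Fintype.card V : ℝ) ^ k)⁻¹ * ∑ e : Fin k → V,
        equivocation fun z => ∑ x, likelihood Q s y x * Q (fun i => x (e i)) z) := by
    intro y
    set v := likelihood Q s y
    have hv : ∀ x, 0 ≤ v x := likelihood_nonneg hQ s y
    have hS : 0 ≤ ∑ x, v x := Finset.sum_nonneg fun x _ => hv x
    rcases hS.eq_or_lt with h0 | h0
    · have : ∀ x, v x = 0 := fun x =>
        (Finset.sum_eq_zero_iff_of_nonneg fun x _ => hv x).1 h0.symm x (Finset.mem_univ x)
      simp [this, equivocation]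
    · have hp : (fun x => v x / ∑ x, v x) ∈ stdSimplex ℝ (V → 𝒳) :=
        ⟨fun x => div_nonneg (hv x) hS, by rw [← Finset.sum_div, div_self h0.ne']⟩
      have hscale : ∀ e : Fin k → V, equivocation (fun z => ∑ x, v x * Q (fun i => x (e i)) z) =
          (∑ x, v x) * ∑ z, negMulLog (∑ x, (v x / ∑ x, v x) * Q (fun i => x (e i)) z) := by
        intro e
        have h1 : ∀ z, ∑ x, v x * Q (fun i => x (e i)) z =
            (∑ x, v x) * ∑ x, (v x / ∑ x, v x) * Q (fun i => x (e i)) z := fun z => by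
          rw [Finset.mul_sum]
          refine Finset.sum_congr rfl fun x _ => ?_
          field_simp
        have h2 : ∑ z, ∑ x, (v x / ∑ x, v x) * Q (fun i => x (e i)) z = 1 := by
          rw [Finset.sum_comm]
          simp only [← Finset.mul_sum, (hQ _).2, mul_one]
          exact hp.2
        simp_rw [h1]
        rw [equivocation_smul, equivocation, h2, Real.negMulLog_one, sub_zero]
      have h3 := mul_le_mul_of_nonneg_left (average_sum_negMulLog_superadditive hQ hH σ hp) hS
      simp_rw [hscale, ← Finset.mul_sum]
      refine le_trans (le_of_eq ?_) (h3.trans_eq ?_) <;> ring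
  have h := mul_le_mul_of_nonneg_left (Finset.sum_le_sum fun y (_ : y ∈ Finset.univ) => key y)
    (prior_pos (𝒳 := 𝒳) V).le
  simp only [predictiveEntropy, ← Finset.mul_sum]
  rw [Finset.sum_add_distrib] at h
  simp only [← Finset.mul_sum] at h
  rw [Finset.sum_comm (s := (Finset.univ : Finset (ι → 𝒴))),
    Finset.sum_comm (s := (Finset.univ : Finset (ι → 𝒴))),
    Finset.sum_comm (s := (Finset.univ : Finset (ι → 𝒴)))] at h
  refine le_trans (le_of_eq ?_) (h.trans_eq ?_) <;> ring

end Interpolation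

/-! ### Entropy of a multi-hypergraph -/

section Graph

variable {𝒳 𝒴 V E : Type*} {k : ℕ} [Fintype 𝒳] [Fintype 𝒴] [Fintype V] [DecidableEq V]
  [Fintype E] [DecidableEq E] {Q : (Fin k → 𝒳) → 𝒴 → ℝ}

/-- The conditional entropy, in nats, for the multi-hypergraph with `g e` copies of the hyperedge
`ends e`, for each `e : E`. -/
def graphEntropy (Q : (Fin k → 𝒳) → 𝒴 → ℝ) (ends : E → Fin k → V) (g : E → ℕ) : ℝ :=
  familyEntropy Q fun p : (e : E) × Fin (g e) => ends p.1

/-- The predictive entropy of a new hyperedge `e` given the symbols of the multi-hypergraph `g`. -/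
def graphPredictiveEntropy (Q : (Fin k → 𝒳) → 𝒴 → ℝ) (ends : E → Fin k → V) (g : E → ℕ)
    (e : Fin k → V) : ℝ :=
  predictiveEntropy Q (fun p : (e : E) × Fin (g e) => ends p.1) e

omit [Fintype V] [DecidableEq E] in
lemma card_sigma_fiber (ends : E → Fin k → V) (g : E → ℕ) (v : Fin k → V) :
    Fintype.card {p : (e : E) × Fin (g e) // ends p.1 = v} = ∑ e with ends e = v, g e := by
  rw [Fintype.card_subtype, ← Finset.univ_sigma_univ, Finset.card_filter, Finset.sum_sigma,
    Finset.sum_filter]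
  refine Finset.sum_congr rfl fun e _ => ?_
  by_cases h : ends e = v <;> simp [h]

lemma graphEntropy_merge {E' : Type*} [Fintype E'] [DecidableEq E'] (f : E → E')
    (ends : E' → Fin k → V) (g : E → ℕ) :
    graphEntropy Q ends (merge f g) = graphEntropy Q (fun e => ends (f e)) g := by
  refine familyEntropy_congr fun v => ?_
  rw [card_sigma_fiber ends, card_sigma_fiber fun e => ends (f e)]
  simp only [merge]
  rw [Finset.sum_filter, Finset.sum_filter, ← Finset.sum_fiberwise Finset.univ f]
  refine Finset.sum_congr rfl fun e' _ => ?_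
  split_ifs with h
  · exact Finset.sum_congr rfl fun e he => by rw [(Finset.mem_filter.1 he).2, if_pos h]
  · exact (Finset.sum_eq_zero fun e he => by rw [(Finset.mem_filter.1 he).2, if_neg h]).symm

lemma graphEntropy_add_single [Nonempty 𝒳] (hQ : IsKernel Q) (ends : E → Fin k → V) (g : E → ℕ)
    (e : E) :
    graphEntropy Q ends (g + Pi.single e 1) =
      graphEntropy Q ends g + noiseEntropy Q (ends e) -
        graphPredictiveEntropy Q ends g (ends e) := by
  rw [graphEntropy, graphEntropy, graphPredictiveEntropy, ← familyEntropy_option hQ]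
  refine familyEntropy_congr fun v => ?_
  have h : Fintype.card
        {i : Option ((e : E) × Fin (g e)) // (i.elim (ends e) fun p => ends p.1) = v} =
      (if ends e = v then 1 else 0) + ∑ e with ends e = v, g e := by
    rw [Fintype.card_subtype, Finset.card_filter, Fintype.sum_option, ← Finset.card_filter,
      ← Fintype.card_subtype, ← card_sigma_fiber]
    rfl
  rw [card_sigma_fiber, h]
  simp only [Pi.add_apply, Finset.sum_add_distrib, add_comm (∑ e with ends e = v, g e)]
  simp [Pi.single_apply, Finset.sum_filter]

lemma graphEntropy_sum {V₁ V₂ E₁ E₂ : Type*} [Fintype V₁] [Fintype V₂] [DecidableEq V₁]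
    [DecidableEq V₂] [Fintype E₁] [Fintype E₂] [DecidableEq E₁] [DecidableEq E₂] [Nonempty 𝒳]
    (hQ : IsKernel Q) (σ : V₁ ⊕ V₂ ≃ V) (ends₁ : E₁ → Fin k → V₁) (ends₂ : E₂ → Fin k → V₂)
    (g : E₁ ⊕ E₂ → ℕ) :
    graphEntropy Q (Sum.elim (fun e j => σ (.inl (ends₁ e j))) fun e j => σ (.inr (ends₂ e j))) g =
      graphEntropy Q ends₁ (fun e => g (.inl e)) + graphEntropy Q ends₂ fun e => g (.inr e) := by
  rw [graphEntropy, graphEntropy, graphEntropy, ← familyEntropy_sum hQ σ,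
    ← familyEntropy_comp_equiv (Equiv.sumSigmaDistrib fun e => Fin (g e))]
  congr 1
  funext ⟨e, i⟩
  rcases e with e | e <;> rfl

variable [Nonempty 𝒳]

lemma abs_graphEntropy_le (hQ : IsKernel Q) (ends : E → Fin k → V) (g : E → ℕ) :
    |graphEntropy Q ends g| ≤ Fintype.card V * Real.log (Fintype.card 𝒳) := by
  rw [graphEntropy, abs_of_nonneg (familyEntropy_nonneg hQ _)]
  exact familyEntropy_le hQ _

lemma abs_noiseEntropy_sub_le (hQ : IsKernel Q) (ends : E → Fin k → V) (g : E → ℕ)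
    (e : Fin k → V) :
    |noiseEntropy Q e - graphPredictiveEntropy Q ends g e| ≤ Real.log (Fintype.card 𝒴) :=
  abs_sub_le_of_nonneg_of_le (noiseEntropy_nonneg hQ _) (noiseEntropy_le hQ _)
    (predictiveEntropy_nonneg hQ _ _) (predictiveEntropy_le hQ _ _)

lemma abs_graphEntropy_add_single_sub_le (hQ : IsKernel Q) (ends : E → Fin k → V) (g : E → ℕ)
    (e : E) :
    |graphEntropy Q ends (g + Pi.single e 1) - graphEntropy Q ends g| ≤
      Real.log (Fintype.card 𝒴) := by
  rw [graphEntropy_add_single hQ, add_sub_assoc, add_sub_cancel_left]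
  exact abs_noiseEntropy_sub_le hQ _ _ _

lemma generator_graphEntropy (hQ : IsKernel Q) (r : E → ℝ≥0) (ends : E → Fin k → V) (g : E → ℕ) :
    generator r (graphEntropy Q ends) g = (∑ e, (r e : ℝ)) * graphEntropy Q ends g +
      ∑ e, (r e : ℝ) *
        (noiseEntropy Q (ends e) - graphPredictiveEntropy Q ends g (ends e)) := by
  rw [generator_apply, Finset.sum_mul, ← Finset.sum_add_distrib]
  refine Finset.sum_congr rfl fun e _ => ?_
  rw [graphEntropy_add_single hQ]
  ring

end Graph

/-! ### Conditional entropy in terms of the multiplicities -/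

section CondEntropy

variable {𝒳 𝒴 : Type*} {k n : ℕ} [Fintype 𝒳] [Fintype 𝒴] {Q : (Fin k → 𝒳) → 𝒴 → ℝ}

lemma condEntropy_eq_graphEntropy [Nonempty 𝒳] (hQ : IsKernel Q) (g : MultiHypergraph k n) :
    condEntropy Q g = graphEntropy Q (fun e : Fin k ↪ Fin n => ⇑e) g / Real.log 2 := by
  have hch : ∀ (x : Fin n → 𝒳) (y : (e : Fin k ↪ Fin n) × Fin (g e) → 𝒴),
      likelihood Q (fun p : (e : Fin k ↪ Fin n) × Fin (g e) => ⇑p.1) y x =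
        channelProb Q g x (fun e i => y ⟨e, i⟩) := fun x y => by
    simp only [likelihood, channelProb]
    rw [← Finset.univ_sigma_univ, Finset.prod_sigma]
  rw [graphEntropy, familyEntropy, Fintype.card_fin]
  change _ = prior 𝒳 n * _ / _
  rw [condEntropy, ← mul_neg, mul_div_assoc]
  congr 1
  rw [Finset.sum_div, Finset.sum_comm, ← Finset.sum_neg_distrib,
    ← (Equiv.piCurry fun (e : Fin k ↪ Fin n) (_ : Fin (g e)) => 𝒴).sum_comp]
  refine Finset.sum_congr rfl fun y _ => ?_
  rw [equivocation_eq_sum_mul_log (likelihood_nonneg hQ _ y), neg_div, Finset.sum_div]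
  congr 1
  refine Finset.sum_congr rfl fun x _ => ?_
  have h1 : reverseProb Q g x (Equiv.piCurry (fun _ _ => 𝒴) y) =
      channelProb Q g x (fun e i => y ⟨e, i⟩) /
        ∑ x, channelProb Q g x (fun e i => y ⟨e, i⟩) := by
    have hp : prior 𝒳 n ≠ 0 := by
      have : (Fintype.card 𝒳 : ℝ) ≠ 0 := by exact_mod_cast Fintype.card_ne_zero
      unfold prior
      positivity
    rw [reverseProb, outputProb, ← Finset.sum_mul]
    change 1 / ((∑ x, channelProb Q g x fun e i => y ⟨e, i⟩) * _) *
      channelProb Q g x (fun e i => y ⟨e, i⟩) * _ = _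
    rw [one_div, mul_inv, mul_assoc, mul_right_comm, mul_assoc, mul_inv_cancel_right₀ hp,
      div_eq_inv_mul]
  rw [h1, Real.logb]
  simp only [hch]
  rw [mul_div_assoc]
  rfl

end CondEntropy

/-! ### Immaterial order of listing -/

section OrderInsensitive

variable {𝒳 𝒴 : Type*} {k n : ℕ} [Fintype 𝒳] [Fintype 𝒴] {Q : (Fin k → 𝒳) → 𝒴 → ℝ}

/-- If the order is immaterial for the kernel, then relisting the hyperedges only relabels their
symbols. -/
lemma familyEntropy_eq_of_perm {V ι : Type*} [Fintype V] [DecidableEq V] [Fintype ι]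
    [DecidableEq ι] (hO : OrderInsensitive Q) {s s' : ι → Fin k → V}
    (h : ∀ i, ∃ π : Equiv.Perm (Fin k), ∀ j, s i j = s' i (π j)) :
    familyEntropy Q s = familyEntropy Q s' := by
  choose π hπ using h
  choose τ hτ using hO
  rw [familyEntropy, familyEntropy, ← (Equiv.piCongrRight fun i => τ (π i)).sum_comp]
  congr 1
  refine Finset.sum_congr rfl fun y _ => ?_
  congr 1
  funext x
  refine Finset.prod_congr rfl fun i _ => ?_
  simp only [hπ, Equiv.piCongrRight_apply, Pi.map_apply]
  exact hτ (π i) (fun j => x (s' i j)) (y i)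

/-- The hyperedge underlying a listing. -/
def vertexSet (e : Fin k ↪ Fin n) : Edge k n := ⟨Finset.univ.map e, by simp⟩

/-- The listing of a hyperedge in increasing order; any other fixed choice would do. -/
def increasingListing (I : Edge k n) : Fin k ↪ Fin n := (I.1.orderEmbOfFin I.2).toEmbedding

lemma vertexSet_increasingListing (I : Edge k n) : vertexSet (increasingListing I) = I :=
  Subtype.ext (Finset.map_orderEmbOfFin_univ I.1 I.2)

lemma vertexSet_eq_iff (e e' : Fin k ↪ Fin n) :
    vertexSet e = vertexSet e' ↔ ∃ π : Equiv.Perm (Fin k), π.toEmbedding.trans e' = e := by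
  constructor
  · intro h
    have h1 : ∀ j, ∃ i, e' i = e j := fun j => by
      have : e j ∈ Finset.univ.map e' := by
        rw [← show Finset.univ.map e = Finset.univ.map e' from congrArg Subtype.val h]
        simp
      simpa using this
    choose π hπ using h1
    have hinj : Function.Injective π := fun a b hab => e.injective (by rw [← hπ, ← hπ, hab])
    refine ⟨Equiv.ofBijective π (Finite.injective_iff_bijective.1 hinj), ?_⟩
    ext j
    simp [hπ]
  · rintro ⟨π, rfl⟩
    refine Subtype.ext ?_
    simp only [vertexSet]
    rw [← Finset.map_map]
    simp

lemma card_vertexSet_fiber (I : Edge k n) :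
    (Finset.univ.filter fun e : Fin k ↪ Fin n => vertexSet e = I).card = k.factorial := by
  have h : (Finset.univ : Finset (Equiv.Perm (Fin k))).card = k.factorial := by
    rw [Finset.card_univ, Fintype.card_perm, Fintype.card_fin]
  rw [← h]
  symm
  refine Finset.card_bij (fun π _ => π.toEmbedding.trans (increasingListing I)) ?_ ?_ ?_
  · intro π _
    rw [Finset.mem_filter]
    exact ⟨Finset.mem_univ _, ((vertexSet_eq_iff _ (increasingListing I)).2 ⟨π, rfl⟩).trans
      (vertexSet_increasingListing I)⟩
  · intro π _ π' _ h
    ext j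
    have := DFunLike.congr_fun h j
    exact congrArg Fin.val (by simpa using this)
  · intro e he
    obtain ⟨π, hπ⟩ := (vertexSet_eq_iff e (increasingListing I)).1
      ((Finset.mem_filter.1 he).2.trans (vertexSet_increasingListing I).symm)
    exact ⟨π, Finset.mem_univ _, hπ⟩

lemma multiplicity_eq_merge (g : MultiHypergraph k n) : multiplicity g = merge vertexSet g := by
  funext I
  simp only [multiplicity, merge, Subtype.ext_iff]
  rfl

lemma graphEntropy_eq_of_orderInsensitive (hO : OrderInsensitive Q) (g : MultiHypergraph k n) :
    graphEntropy Q (fun e : Fin k ↪ Fin n => ⇑e) g =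
      graphEntropy Q (fun I : Edge k n => ⇑(increasingListing I)) (multiplicity g) := by
  rw [multiplicity_eq_merge, graphEntropy_merge]
  refine familyEntropy_eq_of_perm hO fun p => ?_
  obtain ⟨π, hπ⟩ := (vertexSet_eq_iff p.1 (increasingListing (vertexSet p.1))).1
    (vertexSet_increasingListing _).symm
  exact ⟨π, fun j => by conv_lhs => rw [← hπ]
                        rfl⟩

end OrderInsensitive

/-! ### Averages over maps and over injective maps -/

section Average

variable {k n : ℕ}

lemma mul_card_sub_descFactorial_le (k n : ℕ) :
    (n : ℝ) * ((n : ℝ) ^ k - n.descFactorial k) ≤ (k : ℝ) ^ 2 * (n : ℝ) ^ k := by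
  induction k with
  | zero => simp
  | succ k ih =>
    have h1 : ((n : ℝ) - k) * n.descFactorial k ≤ n.descFactorial (k + 1) := by
      rw [Nat.descFactorial_succ]
      push_cast
      gcongr
      rw [sub_le_iff_le_add]
      exact_mod_cast (by omega : n ≤ n - k + k)
    have h2 : (n.descFactorial k : ℝ) ≤ (n : ℝ) ^ k := by
      exact_mod_cast Nat.descFactorial_le_pow n k
    have h3 : (0 : ℝ) ≤ n := Nat.cast_nonneg n
    have h4 : (0 : ℝ) ≤ k := Nat.cast_nonneg k
    calc (n : ℝ) * ((n : ℝ) ^ (k + 1) - n.descFactorial (k + 1))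
        ≤ n * ((n : ℝ) ^ (k + 1) - ((n : ℝ) - k) * n.descFactorial k) := by gcongr
      _ = n * (n * ((n : ℝ) ^ k - n.descFactorial k)) + n * k * n.descFactorial k := by ring
      _ ≤ n * ((k : ℝ) ^ 2 * (n : ℝ) ^ k) + n * k * (n : ℝ) ^ k := by gcongr
      _ ≤ ((k + 1 : ℕ) : ℝ) ^ 2 * (n : ℝ) ^ (k + 1) := by
        push_cast
        rw [pow_succ (n : ℝ) k]
        nlinarith [mul_nonneg (mul_nonneg h3 (pow_nonneg h3 k)) h4,
          mul_nonneg h3 (pow_nonneg h3 k)]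

/-- All but a fraction `O(1/n)` of the maps `Fin k → Fin n` are injective, so a function that is
constant on injective maps has nearly that constant as its average. -/
lemma abs_mul_average_sub_le (hn : 1 ≤ n) {f : (Fin k → Fin n) → ℝ} {c L : ℝ}
    (hf : ∀ e, Function.Injective e → f e = c) (hL : ∀ e, |f e - c| ≤ L) :
    |(n : ℝ) * (((n : ℝ) ^ k)⁻¹ * ∑ e, f e) - n * c| ≤ (k : ℝ) ^ 2 * L := by
  classical
  have hn0 : (0 : ℝ) < n := by exact_mod_cast hn
  have hinj : (Finset.univ.filter fun e : Fin k → Fin n => Function.Injective e).card =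
      n.descFactorial k := by
    rw [← Fintype.card_subtype, Fintype.card_congr (Equiv.subtypeInjectiveEquivEmbedding _ _),
      Fintype.card_embedding_eq, Fintype.card_fin, Fintype.card_fin]
  have hnon : ((Finset.univ.filter fun e : Fin k → Fin n => ¬Function.Injective e).card : ℝ) =
      (n : ℝ) ^ k - n.descFactorial k := by
    have := Finset.card_filter_add_card_filter_not (s := (Finset.univ : Finset (Fin k → Fin n)))
      (fun e => Function.Injective e)
    rw [hinj, Finset.card_univ, Fintype.card_fun, Fintype.card_fin, Fintype.card_fin] at this
    rw [eq_sub_iff_add_eq']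
    exact_mod_cast this
  have hL0 : 0 ≤ L := (abs_nonneg _).trans (hL fun _ => ⟨0, hn⟩)
  have h1 : |∑ e, (f e - c)| ≤ ((n : ℝ) ^ k - n.descFactorial k) * L := by
    rw [← Finset.sum_filter_add_sum_filter_not Finset.univ fun e => Function.Injective e,
      Finset.sum_eq_zero fun e he => sub_eq_zero.2 (hf e (Finset.mem_filter.1 he).2), zero_add,
      ← hnon, ← nsmul_eq_mul]
    exact (Finset.abs_sum_le_sum_abs _ _).trans (Finset.sum_le_card_nsmul _ _ _ fun e _ => hL e)
  have h2 : (n : ℝ) * (((n : ℝ) ^ k)⁻¹ * ∑ e, f e) - n * c =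
      n * (((n : ℝ) ^ k)⁻¹ * ∑ e, (f e - c)) := by
    rw [Finset.sum_sub_distrib, Finset.sum_const, Finset.card_univ, Fintype.card_fun,
      Fintype.card_fin, Fintype.card_fin, nsmul_eq_mul, Nat.cast_pow]
    field_simp
  rw [h2, abs_mul, abs_mul, abs_of_pos hn0, abs_of_pos (by positivity)]
  calc (n : ℝ) * (((n : ℝ) ^ k)⁻¹ * |∑ e, (f e - c)|)
      ≤ n * (((n : ℝ) ^ k)⁻¹ * (((n : ℝ) ^ k - n.descFactorial k) * L)) := by gcongr
    _ = ((n : ℝ) ^ k)⁻¹ * (n * ((n : ℝ) ^ k - n.descFactorial k)) * L := by ring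
    _ ≤ ((n : ℝ) ^ k)⁻¹ * ((k : ℝ) ^ 2 * (n : ℝ) ^ k) * L := by
      refine mul_le_mul_of_nonneg_right (mul_le_mul_of_nonneg_left ?_ (by positivity)) hL0
      exact mul_card_sub_descFactorial_le k n
    _ = (k : ℝ) ^ 2 * L := by field_simp

/-- The averages over all maps and over the injective maps differ by `O(1/n)`. -/
lemma abs_mul_average_sub_mul_average_embedding_le (hk : k ≤ n) (hn : 1 ≤ n)
    {f : (Fin k → Fin n) → ℝ} {L : ℝ} (hL : ∀ e, |f e| ≤ L) :
    |(n : ℝ) * (((n : ℝ) ^ k)⁻¹ * ∑ e, f e) -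
      n * ((n.descFactorial k : ℝ)⁻¹ * ∑ e : Fin k ↪ Fin n, f e)| ≤ (k : ℝ) ^ 2 * (2 * L) := by
  classical
  have hD : (0 : ℝ) < n.descFactorial k := by exact_mod_cast Nat.descFactorial_pos.2 hk
  set c := (n.descFactorial k : ℝ)⁻¹ * ∑ e : Fin k ↪ Fin n, f e with hc
  have hcard : (Fintype.card (Fin k ↪ Fin n) : ℝ) = n.descFactorial k := by
    rw [Fintype.card_embedding_eq, Fintype.card_fin, Fintype.card_fin]
  have hemb : ∀ h : (Fin k → Fin n) → ℝ, ∑ e with Function.Injective e, h e =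
      ∑ e : Fin k ↪ Fin n, h e := fun h => by
    rw [Finset.sum_subtype (p := fun e : Fin k → Fin n => Function.Injective e) _ (by simp),
      ← (Equiv.subtypeInjectiveEquivEmbedding (Fin k) (Fin n)).sum_comp]
    rfl
  have hcL : |c| ≤ L := by
    rw [hc, abs_mul, abs_of_pos (by positivity), inv_mul_le_iff₀ hD, ← hcard, ← nsmul_eq_mul]
    exact (Finset.abs_sum_le_sum_abs _ _).trans (Finset.sum_le_card_nsmul _ _ _ fun e _ => hL _)
  -- Replacing `f` by its mean on the injective maps does not change the sum.
  have hsum : ∑ e, f e = ∑ e, if Function.Injective e then c else f e := by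
    rw [← Finset.sum_filter_add_sum_filter_not Finset.univ fun e : Fin k → Fin n =>
      Function.Injective e, Finset.sum_ite, hemb, Finset.sum_const, nsmul_eq_mul,
      ← Fintype.card_subtype, Fintype.card_congr (Equiv.subtypeInjectiveEquivEmbedding _ _), hcard,
      hc, mul_inv_cancel_left₀ hD.ne']
  rw [hsum]
  refine abs_mul_average_sub_le hn (fun e he => if_pos he) fun e => ?_
  split_ifs
  · simpa using (abs_nonneg _).trans hcL
  · exact (abs_sub _ _).trans (by linarith [hL e])

end Average

/-! ### Comparison of random hypergraphs -/

section Comparison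

variable {𝒳 𝒴 V : Type*} {k : ℕ} [Fintype 𝒳] [Fintype 𝒴] [Nonempty 𝒳] [Fintype V] [DecidableEq V]
  {Q : (Fin k → 𝒳) → 𝒴 → ℝ}

omit [Fintype 𝒳] [Fintype 𝒴] [Nonempty 𝒳] in
lemma sum_pushforward_mul {E E' : Type*} [Fintype E] [Fintype E'] [DecidableEq E'] (f : E → E')
    (r : E → ℝ≥0) (φ : E' → ℝ) :
    ∑ v, ((∑ e with f e = v, r e : ℝ≥0) : ℝ) * φ v = ∑ e, (r e : ℝ) * φ (f e) := by
  rw [← Finset.sum_fiberwise Finset.univ f]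
  refine Finset.sum_congr rfl fun v _ => ?_
  rw [NNReal.coe_sum, Finset.sum_mul]
  exact Finset.sum_congr rfl fun e he => by rw [(Finset.mem_filter.1 he).2]

lemma integral_graphEntropy_eq_pushforward {E : Type*} [Fintype E] [DecidableEq E]
    (hQ : IsKernel Q) (ends : E → Fin k → V) (r : E → ℝ≥0) :
    ∫ g, graphEntropy Q ends g ∂poissonPi r =
      ∫ g, graphEntropy Q id g ∂poissonPi fun v => ∑ e with ends e = v, r e := by
  rw [← integral_comp_merge ends (fun v => rfl) (abs_graphEntropy_le hQ id)]
  simp_rw [graphEntropy_merge]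
  rfl

/-- Comparison of the mean entropies of two Poisson hypergraphs on the same vertex set, possibly
with different sets of edges, from a comparison of the mean effect of one new edge on an arbitrary
graph. -/
lemma integral_graphEntropy_le {E₁ E₂ : Type*} [Fintype E₁] [Fintype E₂] [DecidableEq E₁]
    [DecidableEq E₂] (hQ : IsKernel Q) (ends₁ : E₁ → Fin k → V) (ends₂ : E₂ → Fin k → V)
    {r₁ : E₁ → ℝ≥0} {r₂ : E₂ → ℝ≥0} (hr : ∑ e, (r₁ e : ℝ) = ∑ e, (r₂ e : ℝ)) {c : ℝ}
    (h : ∀ g : (Fin k → V) → ℕ,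
      ∑ e, (r₁ e : ℝ) * (noiseEntropy Q (ends₁ e) - graphPredictiveEntropy Q id g (ends₁ e)) ≤
      ∑ e, (r₂ e : ℝ) * (noiseEntropy Q (ends₂ e) - graphPredictiveEntropy Q id g (ends₂ e)) +
        c) :
    ∫ g, graphEntropy Q ends₁ g ∂poissonPi r₁ ≤ ∫ g, graphEntropy Q ends₂ g ∂poissonPi r₂ + c := by
  rw [integral_graphEntropy_eq_pushforward hQ ends₁, integral_graphEntropy_eq_pushforward hQ ends₂]
  have h1 := sum_pushforward_mul ends₁ r₁ fun _ => 1
  have h2 := sum_pushforward_mul ends₂ r₂ fun _ => 1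
  simp only [mul_one] at h1 h2
  refine integral_poissonPi_le (by rw [h1, h2, hr]) (abs_graphEntropy_le hQ id) fun g => ?_
  rw [generator_graphEntropy hQ, generator_graphEntropy hQ, h1, h2, hr, add_assoc]
  refine add_le_add_right ?_ _
  simp only [id]
  have e1 := sum_pushforward_mul ends₁ r₁ fun v =>
    noiseEntropy Q v - graphPredictiveEntropy Q id g v
  have e2 := sum_pushforward_mul ends₂ r₂ fun v =>
    noiseEntropy Q v - graphPredictiveEntropy Q id g v
  rw [e1, e2]
  exact h g

end Comparison

/-! ### Mean entropies and subadditivity -/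

section Means

variable {𝒳 𝒴 : Type*} {k : ℕ} [Fintype 𝒳] [Fintype 𝒴]

/-- The rate that makes the total intensity `α n` when all `n ^ k` maps are hyperedges. -/
def mapRate (k : ℕ) (α : ℝ) (n : ℕ) : ℝ≥0 := (α * n / (n : ℝ) ^ k).toNNReal

/-- The mean entropy when all maps `Fin k → Fin n` are hyperedges with equal rates, so that the
vertices of a hyperedge are independent and uniform. In this model the empirical laws of
replicas govern the effect of a new hyperedge. -/
def mapMean (Q : (Fin k → 𝒳) → 𝒴 → ℝ) (α : ℝ) (n : ℕ) : ℝ :=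
  ∫ g, graphEntropy Q (id : (Fin k → Fin n) → Fin k → Fin n) g ∂poissonPi fun _ => mapRate k α n

/-- The rate of each listing in the uniformly listed sparse Poisson hypergraph. -/
def listingRate (k : ℕ) (α : ℝ) (n : ℕ) : ℝ≥0 :=
  (α * n / (n.choose k : ℝ) / (k.factorial : ℝ)).toNNReal

/-- The mean entropy, in nats, of the uniformly listed sparse Poisson hypergraph. -/
def listingMean (Q : (Fin k → 𝒳) → 𝒴 → ℝ) (α : ℝ) (n : ℕ) : ℝ :=
  ∫ g, graphEntropy Q (fun e : Fin k ↪ Fin n => ⇑e) g ∂poissonPi fun _ => listingRate k α n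

lemma coe_mapRate {α : ℝ} (hα : 0 ≤ α) (n : ℕ) :
    (mapRate k α n : ℝ) = α * n * ((n : ℝ) ^ k)⁻¹ := by
  rw [mapRate, Real.coe_toNNReal _ (by positivity), div_eq_mul_inv]

lemma coe_listingRate {α : ℝ} (hα : 0 ≤ α) (n : ℕ) :
    (listingRate k α n : ℝ) = α * n * (n.descFactorial k : ℝ)⁻¹ := by
  rw [listingRate, Real.coe_toNNReal _ (by positivity), Nat.descFactorial_eq_factorial_mul_choose,
    div_div, div_eq_mul_inv, Nat.cast_mul, mul_comm (n.choose k : ℝ)]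

lemma sum_mapRate {α : ℝ} (hα : 0 ≤ α) {n : ℕ} (hn : 1 ≤ n) :
    ∑ _e : Fin k → Fin n, (mapRate k α n : ℝ) = α * n := by
  have : (n : ℝ) ≠ 0 := by exact_mod_cast (by omega : n ≠ 0)
  rw [Finset.sum_const, Finset.card_univ, Fintype.card_fun, Fintype.card_fin, Fintype.card_fin,
    nsmul_eq_mul, coe_mapRate hα, Nat.cast_pow]
  field_simp

lemma sum_listingRate {α : ℝ} (hα : 0 ≤ α) {n : ℕ} (hk : k ≤ n) :
    ∑ _e : Fin k ↪ Fin n, (listingRate k α n : ℝ) = α * n := by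
  have : (n.descFactorial k : ℝ) ≠ 0 := by exact_mod_cast (Nat.descFactorial_pos.2 hk).ne'
  rw [Finset.sum_const, Finset.card_univ, Fintype.card_embedding_eq, Fintype.card_fin,
    Fintype.card_fin, nsmul_eq_mul, coe_listingRate hα]
  field_simp

variable [Nonempty 𝒳] {Q : (Fin k → 𝒳) → 𝒴 → ℝ}

/-- Repeated vertices affect a fraction `O(1/n)` of about `α n` hyperedges. -/
lemma abs_listingMean_sub_mapMean_le (hQ : IsKernel Q) {α : ℝ} (hα : 0 ≤ α) {n : ℕ} (hk : k ≤ n)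
    (hn : 1 ≤ n) :
    |listingMean Q α n - mapMean Q α n| ≤
      α * ((k : ℝ) ^ 2 * (2 * Real.log (Fintype.card 𝒴))) := by
  have hsum : ∑ _e : Fin k ↪ Fin n, (listingRate k α n : ℝ) =
      ∑ _e : Fin k → Fin n, (mapRate k α n : ℝ) := by
    rw [sum_listingRate hα hk, sum_mapRate hα hn]
  have key : ∀ g : (Fin k → Fin n) → ℕ,
      |∑ e : Fin k → Fin n, (mapRate k α n : ℝ) *
          (noiseEntropy Q (id e) - graphPredictiveEntropy Q id g (id e)) -
        ∑ e : Fin k ↪ Fin n, (listingRate k α n : ℝ) *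
          (noiseEntropy Q ⇑e - graphPredictiveEntropy Q id g ⇑e)| ≤
      α * ((k : ℝ) ^ 2 * (2 * Real.log (Fintype.card 𝒴))) := fun g => by
    have h := mul_le_mul_of_nonneg_left (abs_mul_average_sub_mul_average_embedding_le hk hn
      fun e => abs_noiseEntropy_sub_le hQ id g e) hα
    rw [← abs_of_nonneg hα, ← abs_mul, abs_of_nonneg hα] at h
    refine le_trans (le_of_eq ?_) h
    rw [← Finset.mul_sum, ← Finset.mul_sum, coe_mapRate hα, coe_listingRate hα]
    simp only [id]
    ring_nf
  refine abs_sub_le_iff.2 ⟨?_, ?_⟩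
  · rw [sub_le_iff_le_add']
    exact integral_graphEntropy_le hQ _ _ hsum fun g => by
      have := (abs_sub_le_iff.1 (key g)).2
      linarith
  · rw [sub_le_iff_le_add']
    exact integral_graphEntropy_le hQ _ _ hsum.symm fun g => by
      have := (abs_sub_le_iff.1 (key g)).1
      linarith

lemma mapMean_zero (hQ : IsKernel Q) (α : ℝ) : mapMean Q α 0 = 0 := by
  have : ∀ g, graphEntropy Q (id : (Fin k → Fin 0) → Fin k → Fin 0) g = 0 := fun g => by
    have := abs_graphEntropy_le hQ (id : (Fin k → Fin 0) → Fin k → Fin 0) g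
    simpa using this
  simp [mapMean, this]

lemma mapMean_nonneg (hQ : IsKernel Q) (α : ℝ) (n : ℕ) : 0 ≤ mapMean Q α n :=
  integral_nonneg fun _ => familyEntropy_nonneg hQ _

lemma map_sumElim_poissonPi {E₁ E₂ : Type*} [Fintype E₁] [Fintype E₂] (r₁ : E₁ → ℝ≥0)
    (r₂ : E₂ → ℝ≥0) :
    MeasurePreserving (fun g : E₁ ⊕ E₂ → ℕ => ((fun e => g (.inl e)), fun e => g (.inr e)))
      (poissonPi (Sum.elim r₁ r₂)) ((poissonPi r₁).prod (poissonPi r₂)) :=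
  measurePreserving_sumPiEquivProdPi fun e => poissonMeasure (Sum.elim r₁ r₂ e)

/-- Subadditivity up to a constant: the right-hand side is the model in which all hyperedges are
local to one of the two parts of the vertex set, and a global hyperedge is more informative than a
local one. -/
lemma mapMean_add_le (hQ : IsKernel Q) (hH : HypothesisH Q) {α : ℝ} (hα : 0 ≤ α) {m n : ℕ}
    (hm : 1 ≤ m) (hn : 1 ≤ n) :
    mapMean Q α (m + n) ≤ mapMean Q α m + mapMean Q α n +
      α * (3 * ((k : ℝ) ^ 2 * Real.log (Fintype.card 𝒴))) := by
  set σ : Fin m ⊕ Fin n ≃ Fin (m + n) := finSumFinEquiv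
  set L := Real.log (Fintype.card 𝒴)
  let ends : (Fin k → Fin m) ⊕ (Fin k → Fin n) → Fin k → Fin (m + n) :=
    Sum.elim (fun e j => σ (.inl (e j))) fun e j => σ (.inr (e j))
  let r : (Fin k → Fin m) ⊕ (Fin k → Fin n) → ℝ≥0 :=
    Sum.elim (fun _ => mapRate k α m) fun _ => mapRate k α n
  have hlocal : ∫ g, graphEntropy Q ends g ∂poissonPi r = mapMean Q α m + mapMean Q α n := by
    have hmp := map_sumElim_poissonPi (fun _ : Fin k → Fin m => mapRate k α m)
      fun _ : Fin k → Fin n => mapRate k α n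
    have h1 : ∀ g, graphEntropy Q ends g =
        graphEntropy Q id (fun e => g (.inl e)) + graphEntropy Q id fun e => g (.inr e) := fun g =>
      graphEntropy_sum hQ σ id id g
    have i1 : Integrable (graphEntropy Q (id : (Fin k → Fin m) → Fin k → Fin m))
        (poissonPi fun _ => mapRate k α m) := integrable_of_bounded _ (abs_graphEntropy_le hQ _)
    have i2 : Integrable (graphEntropy Q (id : (Fin k → Fin n) → Fin k → Fin n))
        (poissonPi fun _ => mapRate k α n) := integrable_of_bounded _ (abs_graphEntropy_le hQ _)
    simp_rw [h1]
    have h2 := integral_map (μ := poissonPi r) hmp.measurable.aemeasurable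
      (f := fun p => graphEntropy Q id p.1 + graphEntropy Q id p.2)
      (Measurable.of_discrete.aestronglyMeasurable)
    rw [hmp.map_eq, integral_add (i1.comp_fst _) (i2.comp_snd _), integral_fun_fst,
      integral_fun_snd] at h2
    simpa [mapMean] using h2.symm
  rw [← hlocal]
  have hm0 : (0 : ℝ) < m := by exact_mod_cast hm
  have hn0 : (0 : ℝ) < n := by exact_mod_cast hn
  have hmn : 1 ≤ m + n := by omega
  refine integral_graphEntropy_le hQ _ _ ?_ fun g => ?_
  · rw [sum_mapRate hα hmn, Fintype.sum_sum_type]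
    simp only [r, Sum.elim_inl, Sum.elim_inr]
    rw [sum_mapRate hα hm, sum_mapRate hα hn]
    push_cast
    ring
  -- The noise term is constant on injective maps, hence its averages agree up to `O(1)`.
  set h₀ := noiseEntropy Q (id : Fin k → Fin k)
  have hinj : ∀ {N : ℕ} (e : Fin k → Fin N), Function.Injective e → noiseEntropy Q e = h₀ :=
    fun e he => by
      rw [noiseEntropy_of_injective he, ← noiseEntropy_of_injective Function.injective_id]
  have hbd : ∀ {N : ℕ} (e : Fin k → Fin N), |noiseEntropy Q e - h₀| ≤ L := fun e =>
    abs_sub_le_of_nonneg_of_le (noiseEntropy_nonneg hQ _) (noiseEntropy_le hQ _)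
      (noiseEntropy_nonneg hQ _) (noiseEntropy_le hQ _)
  have a0 := abs_le.1 (abs_mul_average_sub_le hmn (f := fun e => noiseEntropy Q e)
    (fun e he => hinj e he) fun e => hbd e)
  have a1 := abs_le.1 (abs_mul_average_sub_le hm
    (f := fun e => noiseEntropy Q fun j => σ (.inl (e j)))
    (fun e he => hinj _ ((σ.injective.comp Sum.inl_injective).comp he)) fun e => hbd _)
  have a2 := abs_le.1 (abs_mul_average_sub_le hn
    (f := fun e => noiseEntropy Q fun j => σ (.inr (e j)))
    (fun e he => hinj _ ((σ.injective.comp Sum.inr_injective).comp he)) fun e => hbd _)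
  have : Nonempty (Fin m) := ⟨⟨0, hm⟩⟩
  have : Nonempty (Fin n) := ⟨⟨0, hn⟩⟩
  have b := average_predictiveEntropy_superadditive hQ hH σ
    fun p : (e : Fin k → Fin (m + n)) × Fin (g e) => id p.1
  simp only [Fintype.card_fin] at b
  rw [Fintype.sum_sum_type]
  simp only [r, ends, Sum.elim_inl, Sum.elim_inr, id, ← Finset.mul_sum, coe_mapRate hα,
    Finset.sum_sub_distrib]
  simp only [graphPredictiveEntropy, id]
  push_cast at a0 b ⊢
  simp only [id] at b
  have hfin := mul_le_mul_of_nonneg_left (add_le_add (add_le_add (add_le_add a0.2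
    (neg_le_neg a1.1)) (neg_le_neg a2.1)) b) hα
  linarith

end Means

/-! ### Convergence of the means -/

section Limit

variable {𝒳 𝒴 : Type*} {k : ℕ} [Fintype 𝒳] [Fintype 𝒴] [Nonempty 𝒳] {Q : (Fin k → 𝒳) → 𝒴 → ℝ}

/-- Fekete's lemma, after a constant is added to make the means subadditive. -/
lemma exists_tendsto_mapMean_div (hQ : IsKernel Q) (hH : HypothesisH Q) {α : ℝ} (hα : 0 ≤ α) :
    ∃ C : ℝ, Tendsto (fun n : ℕ => mapMean Q α n / n) atTop (𝓝 C) := by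
  set K := α * (3 * ((k : ℝ) ^ 2 * Real.log (Fintype.card 𝒴)))
  have hK : 0 ≤ K := by have := Real.log_natCast_nonneg (Fintype.card 𝒴); positivity
  have hsub : Subadditive fun n => mapMean Q α n + K := fun m n => by
    rcases Nat.eq_zero_or_pos m with rfl | hm
    · simp only [Nat.zero_add, mapMean_zero hQ]
      linarith
    · rcases Nat.eq_zero_or_pos n with rfl | hn
      · simp only [Nat.add_zero, mapMean_zero hQ]
        linarith
      · have := mapMean_add_le hQ hH hα hm hn
        change _ ≤ _
        linarith
  have hlim := hsub.tendsto_lim ⟨0, by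
    rintro _ ⟨n, rfl⟩
    exact div_nonneg (add_nonneg (mapMean_nonneg hQ α n) hK) (Nat.cast_nonneg n)⟩
  refine ⟨hsub.lim, ?_⟩
  have h0 := tendsto_const_div_atTop_nhds_zero_nat K
  have := hlim.sub h0
  rw [sub_zero] at this
  refine this.congr fun n => ?_
  rw [← sub_div, add_sub_cancel_right]

lemma exists_tendsto_listingMean_div (hQ : IsKernel Q) (hH : HypothesisH Q) {α : ℝ}
    (hα : 0 ≤ α) :
    ∃ C : ℝ, Tendsto (fun n : ℕ => listingMean Q α n / n) atTop (𝓝 C) := by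
  obtain ⟨C, hC⟩ := exists_tendsto_mapMean_div hQ hH hα
  refine ⟨C, ?_⟩
  set K := α * ((k : ℝ) ^ 2 * (2 * Real.log (Fintype.card 𝒴)))
  have h0 : Tendsto (fun n : ℕ => listingMean Q α n / n - mapMean Q α n / n) atTop (𝓝 0) := by
    refine squeeze_zero_norm' ?_ (tendsto_const_div_atTop_nhds_zero_nat K)
    filter_upwards [eventually_ge_atTop k, eventually_ge_atTop 1] with n hk hn
    rw [← sub_div, Real.norm_eq_abs, abs_div, Nat.abs_cast]
    gcongr
    exact abs_listingMean_sub_mapMean_le hQ hα hk hn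
  simpa using h0.add hC

end Limit

/-! ### Law and concentration of the conditional entropy -/

section Law

variable {𝒳 𝒴 : Type*} {k n : ℕ} [Fintype 𝒳] [Fintype 𝒴] [Nonempty 𝒳] {Q : (Fin k → 𝒳) → 𝒴 → ℝ}
  {Ω : Type*} [MeasurableSpace Ω] {P : Measure Ω} {α : ℝ} {G : Ω → MultiHypergraph k n}

lemma rate_edge_eq_sum_listingRate (hα : 0 ≤ α) (I : Edge k n) :
    (α * n / (n.choose k : ℝ)).toNNReal =
      ∑ e : Fin k ↪ Fin n with vertexSet e = I, listingRate k α n := by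
  rw [Finset.sum_const, card_vertexSet_fiber, nsmul_eq_mul]
  refine NNReal.coe_injective ?_
  rw [NNReal.coe_mul, NNReal.coe_natCast, listingRate, Real.coe_toNNReal _ (by positivity),
    Real.coe_toNNReal _ (by positivity)]
  field_simp

/-- Under either assumption on the listing, the entropy has the law that it has for the uniformly
listed hypergraph: if the order is immaterial it is a function of the multiplicities `m_I`. -/
lemma map_condEntropy (hQ : IsKernel Q) (hα : 0 ≤ α)
    (hG : (OrderInsensitive Q ∧ IsSparsePoisson P α G) ∨ IsUniformlyListedSparsePoisson P α G) :
    AEMeasurable (fun ω => condEntropy Q (G ω)) P ∧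
      P.map (fun ω => condEntropy Q (G ω)) =
        (poissonPi fun _ : Fin k ↪ Fin n => listingRate k α n).map (condEntropy Q) := by
  rcases hG with ⟨hO, hG⟩ | hG
  · have hmeas : AEMeasurable (fun ω => multiplicity (G ω)) P :=
      aemeasurable_of_map_neZero (by rw [hG]; infer_instance)
    let F : (Edge k n → ℕ) → ℝ := fun m =>
      graphEntropy Q (fun I : Edge k n => ⇑(increasingListing I)) m / Real.log 2
    have hF : ∀ g : MultiHypergraph k n, condEntropy Q g = F (multiplicity g) := fun g => by
      rw [condEntropy_eq_graphEntropy hQ, graphEntropy_eq_of_orderInsensitive hO]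
    have hFm : Measurable F := .of_discrete
    have hrate := map_merge_poissonPi vertexSet (rate_edge_eq_sum_listingRate (n := n) (k := k) hα)
    refine ⟨by simp_rw [hF]; exact hFm.comp_aemeasurable hmeas, ?_⟩
    have h1 : P.map (fun ω => condEntropy Q (G ω)) =
        (P.map fun ω => multiplicity (G ω)).map F := by
      rw [AEMeasurable.map_map_of_aemeasurable hFm.aemeasurable hmeas]
      congr 1
      funext ω
      exact hF _
    rw [h1, hG]
    change (poissonPi _).map F = _
    rw [← hrate, Measure.map_map hFm .of_discrete]
    congr 1
    funext g
    rw [hF, multiplicity_eq_merge]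
    rfl
  · have hmeas : AEMeasurable G P :=
      aemeasurable_of_map_neZero (by rw [hG]; infer_instance)
    have hFm : Measurable (condEntropy Q : MultiHypergraph k n → ℝ) := .of_discrete
    refine ⟨hFm.comp_aemeasurable hmeas, ?_⟩
    have h1 : P.map (fun ω => condEntropy Q (G ω)) = (P.map G).map (condEntropy Q) :=
      (AEMeasurable.map_map_of_aemeasurable hFm.aemeasurable hmeas).symm
    rw [h1, hG]
    rfl

lemma abs_condEntropy_le (hQ : IsKernel Q) (g : MultiHypergraph k n) :
    |condEntropy Q g| ≤ n * Real.log (Fintype.card 𝒳) / Real.log 2 := by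
  have h2 : 0 < Real.log 2 := Real.log_pos one_lt_two
  rw [condEntropy_eq_graphEntropy hQ, abs_div, abs_of_pos h2]
  gcongr
  simpa using abs_graphEntropy_le hQ (fun e : Fin k ↪ Fin n => ⇑e) g

lemma integral_condEntropy_poissonPi (hQ : IsKernel Q) :
    ∫ g, condEntropy Q g ∂(poissonPi fun _ : Fin k ↪ Fin n => listingRate k α n) =
      listingMean Q α n / Real.log 2 := by
  simp_rw [condEntropy_eq_graphEntropy hQ]
  rw [integral_div, listingMean]

lemma integral_condEntropy (hQ : IsKernel Q) (hα : 0 ≤ α)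
    (hG : (OrderInsensitive Q ∧ IsSparsePoisson P α G) ∨ IsUniformlyListedSparsePoisson P α G) :
    ∫ ω, condEntropy Q (G ω) ∂P = listingMean Q α n / Real.log 2 := by
  obtain ⟨hm, hlaw⟩ := map_condEntropy hQ hα hG
  rw [← integral_condEntropy_poissonPi hQ]
  have h1 := integral_map hm (f := fun z : ℝ => z) measurable_id.aestronglyMeasurable
  have h2 := integral_map (μ := poissonPi fun _ : Fin k ↪ Fin n => listingRate k α n)
    (φ := condEntropy Q) (Measurable.of_discrete).aemeasurable (f := fun z : ℝ => z)
    measurable_id.aestronglyMeasurable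
  rw [← h1, hlaw, h2]

/-- Concentration of the entropy, which changes by at most `log₂ |𝒴|` when a hyperedge is added. -/
lemma measureReal_abs_condEntropy_sub_ge_le (hQ : IsKernel Q) (hα : 0 ≤ α) (hk : k ≤ n)
    (hG : (OrderInsensitive Q ∧ IsSparsePoisson P α G) ∨ IsUniformlyListedSparsePoisson P α G)
    {θ : ℝ} (hθ : 0 ≤ θ) (t : ℝ) :
    P.real {ω | t ≤ |condEntropy Q (G ω) - listingMean Q α n / Real.log 2|} ≤
      2 * Real.exp (-θ * t + α * n *
        (2 * Real.cosh (θ * (Real.log (Fintype.card 𝒴) / Real.log 2)) - 2)) := by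
  obtain ⟨hm, hlaw⟩ := map_condEntropy hQ hα hG
  have h2 : 0 < Real.log 2 := Real.log_pos one_lt_two
  have h := poissonPi_real_abs_sub_ge_le (fun _ : Fin k ↪ Fin n => listingRate k α n)
    (F := condEntropy Q) (c := Real.log (Fintype.card 𝒴) / Real.log 2) (abs_condEntropy_le hQ)
    (fun g e => by
      rw [condEntropy_eq_graphEntropy hQ, condEntropy_eq_graphEntropy hQ, ← sub_div, abs_div,
        abs_of_pos h2]
      gcongr
      exact abs_graphEntropy_add_single_sub_le hQ _ _ _) hθ t
  rw [integral_condEntropy_poissonPi hQ, sum_listingRate hα hk] at h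
  refine le_trans (le_of_eq ?_) h
  have hs : MeasurableSet {z : ℝ | t ≤ |z - listingMean Q α n / Real.log 2|} :=
    measurableSet_le measurable_const (by fun_prop)
  have e1 := Measure.map_apply_of_aemeasurable hm hs
  have e2 := Measure.map_apply_of_aemeasurable
    (μ := poissonPi fun _ : Fin k ↪ Fin n => listingRate k α n)
    (f := condEntropy Q) (Measurable.of_discrete).aemeasurable hs
  rw [hlaw, e2] at e1
  exact congrArg ENNReal.toReal e1.symm

end Law

/-- As `2 cosh x - 2 = O(x²)`, the Chernoff exponent is negative for small `θ > 0`. -/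
lemma exists_mul_cosh_sub_lt {α ε : ℝ} (hα : 0 ≤ α) (hε : 0 < ε) (c : ℝ) :
    ∃ θ : ℝ, 0 ≤ θ ∧ α * (2 * Real.cosh (θ * c) - 2) < θ * ε := by
  set D := 4 * α * (c ^ 2 + 1) / ε + |c| + 1 with hD
  have hD1 : |c| + 1 ≤ D := by
    have : 0 ≤ 4 * α * (c ^ 2 + 1) / ε := by positivity
    linarith
  have hD0 : 0 < D := (by positivity : (0 : ℝ) < |c| + 1).trans_le hD1
  have hDα : 4 * α * (c ^ 2 + 1) < D * ε := by
    rw [← div_lt_iff₀ hε, hD]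
    linarith [abs_nonneg c]
  refine ⟨D⁻¹, by positivity, ?_⟩
  have hx : (D⁻¹ * c) ^ 2 ≤ 1 := by
    rw [sq_le_one_iff_abs_le_one, abs_mul, abs_of_pos (by positivity), inv_mul_le_iff₀ hD0]
    linarith
  have hcosh : 2 * Real.cosh (D⁻¹ * c) - 2 ≤ 2 * (D⁻¹ * c) ^ 2 := by
    have h1 := Real.cosh_le_exp_half_sq (D⁻¹ * c)
    have h2 := Real.abs_exp_sub_one_le (x := (D⁻¹ * c) ^ 2 / 2)
      (by rw [abs_of_nonneg (by positivity)]; linarith)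
    rw [abs_of_nonneg (by positivity : (0 : ℝ) ≤ (D⁻¹ * c) ^ 2 / 2)] at h2
    linarith [le_abs_self (Real.exp ((D⁻¹ * c) ^ 2 / 2) - 1)]
  calc α * (2 * Real.cosh (D⁻¹ * c) - 2) ≤ α * (2 * (D⁻¹ * c) ^ 2) := by gcongr
    _ = D⁻¹ * (D⁻¹ * (2 * α * c ^ 2)) := by ring
    _ < D⁻¹ * ε := by
      gcongr
      rw [inv_mul_lt_iff₀ hD0]
      nlinarith [mul_nonneg hα (sq_nonneg c)]

/-! ### Almost sure convergence -/

section AlmostSure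

variable {𝒳 𝒴 : Type*} {k : ℕ} [Fintype 𝒳] [Fintype 𝒴] [Nonempty 𝒳] {Q : (Fin k → 𝒳) → 𝒴 → ℝ}
  {Ω : Type*} [MeasurableSpace Ω] {P : Measure Ω} [IsProbabilityMeasure P] {α : ℝ}
  {G : (n : ℕ) → Ω → MultiHypergraph k n}

lemma ae_eventually_abs_condEntropy_sub_lt (hQ : IsKernel Q) (hα : 0 ≤ α)
    (hG : ∀ n, k ≤ n → (OrderInsensitive Q ∧ IsSparsePoisson P α (G n)) ∨
      IsUniformlyListedSparsePoisson P α (G n)) {ε : ℝ} (hε : 0 < ε) :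
    ∀ᵐ ω ∂P, ∀ᶠ n in atTop,
      |condEntropy Q (G n ω) - listingMean Q α n / Real.log 2| < ε * n := by
  obtain ⟨θ, hθ, hlt⟩ :=
    exists_mul_cosh_sub_lt hα hε (Real.log (Fintype.card 𝒴) / Real.log 2)
  set δ := θ * ε -
    α * (2 * Real.cosh (θ * (Real.log (Fintype.card 𝒴) / Real.log 2)) - 2) with hδ
  have hδ0 : 0 < δ := sub_pos.2 hlt
  let s : ℕ → Set Ω := fun n =>
    {ω | k ≤ n ∧ ε * n ≤ |condEntropy Q (G n ω) - listingMean Q α n / Real.log 2|}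
  have hs : ∀ n, P (s n) ≤ ENNReal.ofReal (2 * Real.exp (-δ) ^ n) := fun n => by
    by_cases hk : k ≤ n
    · have h := measureReal_abs_condEntropy_sub_ge_le hQ hα hk (hG n hk) hθ (ε * n)
      rw [← ofReal_measureReal]
      refine ENNReal.ofReal_le_ofReal ?_
      simp only [s, hk, true_and]
      refine h.trans_eq ?_
      rw [← Real.exp_nat_mul, hδ]
      ring_nf
    · simp [s, hk]
  have hsum : Summable fun n : ℕ => 2 * Real.exp (-δ) ^ n :=
    (summable_geometric_of_lt_one (Real.exp_pos _).le 
      ((Real.exp_lt_exp.2 (by linarith)).trans_eq Real.exp_zero)).mul_left 2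
  have hbc := ae_eventually_notMem (μ := P) (s := s)
    (ne_top_of_le_ne_top hsum.tsum_ofReal_ne_top (ENNReal.tsum_le_tsum hs))
  filter_upwards [hbc] with ω hω
  filter_upwards [hω, eventually_ge_atTop k] with n hn hk
  by_contra hcon
  exact hn ⟨hk, not_lt.1 hcon⟩

lemma ae_tendsto_condEntropy_div (hQ : IsKernel Q) (hα : 0 ≤ α)
    (hG : ∀ n, k ≤ n → (OrderInsensitive Q ∧ IsSparsePoisson P α (G n)) ∨
      IsUniformlyListedSparsePoisson P α (G n)) {C : ℝ}
    (hC : Tendsto (fun n : ℕ => listingMean Q α n / n) atTop (𝓝 C)) :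
    ∀ᵐ ω ∂P, Tendsto (fun n : ℕ => 1 / (n : ℝ) * condEntropy Q (G n ω)) atTop
      (𝓝 (C / Real.log 2)) := by
  have hae : ∀ᵐ ω ∂P, ∀ j : ℕ, ∀ᶠ n in atTop,
      |condEntropy Q (G n ω) - listingMean Q α n / Real.log 2| < 1 / ((j : ℝ) + 1) * n :=
    ae_all_iff.2 fun j => ae_eventually_abs_condEntropy_sub_lt hQ hα hG (by positivity)
  filter_upwards [hae] with ω hω
  have h0 : Tendsto (fun n : ℕ => 1 / (n : ℝ) * condEntropy Q (G n ω) -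
      listingMean Q α n / n / Real.log 2) atTop (𝓝 0) := by
    rw [Metric.tendsto_atTop']
    intro ε hε
    obtain ⟨j, hj⟩ := exists_nat_one_div_lt hε
    obtain ⟨N, hN⟩ := eventually_atTop.1 (hω j)
    refine ⟨N, fun n hn => ?_⟩
    have hn0 : (0 : ℝ) < n := by exact_mod_cast (Nat.zero_le N).trans_lt hn
    have h1 := hN n hn.le
    rw [Real.dist_eq, sub_zero, show 1 / (n : ℝ) * condEntropy Q (G n ω) -
      listingMean Q α n / n / Real.log 2 =
        (condEntropy Q (G n ω) - listingMean Q α n / Real.log 2) / n by ring, abs_div,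
      abs_of_pos hn0, div_lt_iff₀ hn0]
    exact h1.trans (by gcongr)
  simpa using h0.add (hC.div_const (Real.log 2))

end AlmostSure

end GraphicalChannel

end

open GraphicalChannel in
theorem theorem2 {𝒳 : Type*} {𝒴 : Type*} [Fintype 𝒳] [Nonempty 𝒳] [Fintype 𝒴]
    (k : ℕ) (hk : 1 ≤ k) (α : ℝ) (hα : 0 < α)
    (Q : (Fin k → 𝒳) → 𝒴 → ℝ) (hQ : IsKernel Q) (hH : HypothesisH Q) :
    ∃ C : ℝ, ∀ (Ω : Type*) [MeasurableSpace Ω] (P : Measure Ω) [IsProbabilityMeasure P]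
      (G : (n : ℕ) → Ω → MultiHypergraph k n),
      (OrderInsensitive Q ∧ ∀ n, k ≤ n → IsSparsePoisson P α (G n)) ∨
        (∀ n, k ≤ n → IsUniformlyListedSparsePoisson P α (G n)) →
      (∀ n, Integrable (fun ω => condEntropy Q (G n ω)) P) ∧
      Tendsto (fun n : ℕ => 1 / (n : ℝ) * ∫ ω, condEntropy Q (G n ω) ∂P) atTop (𝓝 C) ∧
      ∀ᵐ ω ∂P, Tendsto (fun n : ℕ => 1 / (n : ℝ) * condEntropy Q (G n ω)) atTop (𝓝 C) := by
  obtain ⟨C, hC⟩ := exists_tendsto_listingMean_div hQ hH hα.le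
  refine ⟨C / Real.log 2, fun Ω _ P _ G hG => ?_⟩
  have hG' : ∀ n, k ≤ n → (OrderInsensitive Q ∧ IsSparsePoisson P α (G n)) ∨
      IsUniformlyListedSparsePoisson P α (G n) := fun n hn =>
    hG.imp (fun h => ⟨h.1, h.2 n hn⟩) fun h => h n hn
  refine ⟨fun n => ?_, ?_, ae_tendsto_condEntropy_div hQ hα.le hG' hC⟩
  · rcases le_or_gt k n with hn | hn
    · exact Integrable.of_bound (map_condEntropy hQ hα.le (hG' n hn)).1.aestronglyMeasurable _
        (ae_of_all _ fun ω => abs_condEntropy_le hQ (G n ω))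
    · -- For `n < k` there is no hyperedge, and only one hypergraph.
      have : IsEmpty (Fin k ↪ Fin n) := ⟨fun e => by
        have := Fintype.card_le_of_embedding e
        simp only [Fintype.card_fin] at this
        omega⟩
      have hconst : ∀ ω, condEntropy Q (G n ω) = condEntropy Q (0 : MultiHypergraph k n) :=
        fun ω => by rw [Subsingleton.elim (G n ω) 0]
      simp_rw [hconst]
      exact integrable_const _
  · refine (hC.div_const (Real.log 2)).congr' ?_
    filter_upwards [eventually_ge_atTop k] with n hn
    rw [integral_condEntropy hQ hα.le (hG' n hn)]
    ring
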